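/- Let $p$ be a prime, let $m\ge 0$ be an integer, and let $F_0$ be a field whose characteristic is either $0$ or at least $p$. If $\operatorname{char}(F_0)\neq p$, assume that $F_0$ contains a primitive $p$-th root of unity $\rho$. Let $F$ be either the field $F_0(\alpha_1,\beta_1,\dots,\alpha_m,\beta_m)$ of rational functions in $2m$ independent indeterminates or the field of iterated Laurent series $F_0(\!(\alpha_1^{-1})\!)(\!(\beta_1^{-1})\!)\cdots(\!(\alpha_m^{-1})\!)(\!(\beta_m^{-1})\!)$. Define the $F$-algebra $A$ as follows. - If $\operatorname{char}(F_0)\neq p$, let $A=(\alpha_1,\beta_1)_{p,F}\otimes_F\cdots\otimes_F(\alpha_m,\beta_m)_{p,F}$, where $(\alpha,\beta)_{p,F}=F\langle x,y : x^p=\alpha,\ y^p=\beta,\ yxy^{-1}=\rho x\rangle$. - If $\operatorname{char}(F_0)=p$, let $A=[\alpha_1,\beta_1)_{p,F}\otimes_F\cdots\otimes_F[\alpha_m,\beta_m)_{p,F}$, where $[\alpha,\beta)_{p,F}=F\langle x,y : x^p-x=\alpha,\ y^p=\beta,\ yxy^{-1}=x+1\rangle$. Let $\operatorname{Tr}:A\to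 F$ be the reduced trace, i.e. the matrix trace under an isomorphism $A\otimes_F K\cong M_{p^m}(K)$, where $K$ is an algebraic closure of $F$. Then every $F$-linear subspace $V\subseteq A$ such that $\operatorname{Tr}(v^{p-1})=0$ for all $v\in V$ satisfies $$\dim_F V\le \frac{p^{2m}-1}{p-1}.$$ -/

import Mathlib

open scoped TensorProduct

universe u

noncomputable section

/-- Relations of the symbol algebra `(α, β)_{p,F}` (characteristic different from `p`, `ρ` a primitive
`p`-th root of unity) on the free generators `x = ι 0`, `y = ι 1`. For `β ≠ 0` the element `y` is
invertible, so that `y x = ρ x y` is the relation `y x y⁻¹ = ρ x`. -/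
inductive SymbolRel {F : Type u} [Field F] (p : ℕ) (ρ α β : F) :
    FreeAlgebra F (Fin 2) → FreeAlgebra F (Fin 2) → Prop
  | x_pow : SymbolRel p ρ α β (FreeAlgebra.ι F 0 ^ p) (algebraMap F _ α)
  | y_pow : SymbolRel p ρ α β (FreeAlgebra.ι F 1 ^ p) (algebraMap F _ β)
  | comm : SymbolRel p ρ α β (FreeAlgebra.ι F 1 * FreeAlgebra.ι F 0)
      (algebraMap F _ ρ * FreeAlgebra.ι F 0 * FreeAlgebra.ι F 1)

/-- The symbol algebra
`(α, β)_{p,F} = F⟨x, y : x ^ p = α, y ^ p = β, y x y⁻¹ = ρ x⟩` (for `char F ≠ p`). -/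
def SymbolAlgebra {F : Type u} [Field F] (p : ℕ) (ρ α β : F) : Type u :=
  RingQuot (SymbolRel p ρ α β)

instance {F : Type u} [Field F] (p : ℕ) (ρ α β : F) : Ring (SymbolAlgebra p ρ α β) :=
  inferInstanceAs (Ring (RingQuot (SymbolRel p ρ α β)))

instance {F : Type u} [Field F] (p : ℕ) (ρ α β : F) : Algebra F (SymbolAlgebra p ρ α β) :=
  inferInstanceAs (Algebra F (RingQuot (SymbolRel p ρ α β)))

/-- Relations of the symbol algebra `[α, β)_{p,F}` (characteristic `p`) on the free generators
`x = ι 0`, `y = ι 1`. For `β ≠ 0` the element `y` is invertible, so that `y x = (x + 1) y` is the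
relation `y x y⁻¹ = x + 1`. -/
inductive CharPSymbolRel {F : Type u} [Field F] (p : ℕ) (α β : F) :
    FreeAlgebra F (Fin 2) → FreeAlgebra F (Fin 2) → Prop
  | x_pow : CharPSymbolRel p α β (FreeAlgebra.ι F 0 ^ p - FreeAlgebra.ι F 0) (algebraMap F _ α)
  | y_pow : CharPSymbolRel p α β (FreeAlgebra.ι F 1 ^ p) (algebraMap F _ β)
  | comm : CharPSymbolRel p α β (FreeAlgebra.ι F 1 * FreeAlgebra.ι F 0)
      ((FreeAlgebra.ι F 0 + 1) * FreeAlgebra.ι F 1)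

/-- The symbol algebra
`[α, β)_{p,F} = F⟨x, y : x ^ p - x = α, y ^ p = β, y x y⁻¹ = x + 1⟩` (for `char F = p`). -/
def CharPSymbolAlgebra {F : Type u} [Field F] (p : ℕ) (α β : F) : Type u :=
  RingQuot (CharPSymbolRel p α β)

instance {F : Type u} [Field F] (p : ℕ) (α β : F) : Ring (CharPSymbolAlgebra p α β) :=
  inferInstanceAs (Ring (RingQuot (CharPSymbolRel p α β)))

instance {F : Type u} [Field F] (p : ℕ) (α β : F) : Algebra F (CharPSymbolAlgebra p α β) :=
  inferInstanceAs (Algebra F (RingQuot (CharPSymbolRel p α β)))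

/-- The tensor product `(α₁, β₁)_{p,F} ⊗ ⋯ ⊗ (αₘ, βₘ)_{p,F}` over `F`. -/
abbrev SymbolTensor {F : Type u} [Field F] (p m : ℕ) (ρ : F) (α β : Fin m → F) : Type u :=
  ⨂[F] i : Fin m, SymbolAlgebra p ρ (α i) (β i)

/-- The tensor product `[α₁, β₁)_{p,F} ⊗ ⋯ ⊗ [αₘ, βₘ)_{p,F}` over `F`. -/
abbrev CharPSymbolTensor {F : Type u} [Field F] (p m : ℕ) (α β : Fin m → F) : Type u :=
  ⨂[F] i : Fin m, CharPSymbolAlgebra p (α i) (β i)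

/-- `t : F` is the trace of `a` in a matrix algebra over the algebraic closure `K` of `F` under some
splitting `K ⊗ A ≃ M_d(K)`. -/
def IsReducedTrace (F : Type u) [Field F] {A : Type u} [Ring A] [Algebra F A] (a : A) (t : F) :
    Prop :=
  ∃ (d : ℕ) (e : AlgebraicClosure F ⊗[F] A ≃ₐ[AlgebraicClosure F]
      Matrix (Fin d) (Fin d) (AlgebraicClosure F)),
    (e (1 ⊗ₜ[F] a)).trace = algebraMap F (AlgebraicClosure F) t

open Classical in
/-- The reduced trace `A → F` of a central simple `F`-algebra `A`. (The value does not depend on the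
splitting; where there is no value in `F`, which does not happen for central simple `A`, it is set
to `0`.) -/
def reducedTrace (F : Type u) [Field F] {A : Type u} [Ring A] [Algebra F A] (a : A) : F :=
  if h : ∃ t : F, IsReducedTrace F a t then h.choose else 0

/-- The rational function field `F₀(α₁, β₁, …, αₘ, βₘ)` in `2m` independent indeterminates. -/
abbrev RatField (m : ℕ) (F₀ : Type u) [Field F₀] : Type u :=
  FractionRing (MvPolynomial (Fin m ⊕ Fin m) F₀)

namespace RatField

/-- The indeterminate `αᵢ`. -/
def alpha (m : ℕ) (F₀ : Type u) [Field F₀] (i : Fin m) : RatField m F₀ :=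
  algebraMap (MvPolynomial (Fin m ⊕ Fin m) F₀) _ (MvPolynomial.X (Sum.inl i))

/-- The indeterminate `βᵢ`. -/
def beta (m : ℕ) (F₀ : Type u) [Field F₀] (i : Fin m) : RatField m F₀ :=
  algebraMap (MvPolynomial (Fin m ⊕ Fin m) F₀) _ (MvPolynomial.X (Sum.inr i))

end RatField

/-- The iterated Laurent series field `K((α₁⁻¹))((β₁⁻¹))⋯((αₘ⁻¹))((βₘ⁻¹))`. The recursion adjoins the
innermost pair of variables first. -/
def IterLaurent : (m : ℕ) → (K : Type u) → [Field K] → Type u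
  | 0, K, _ => K
  | m + 1, K, _ => IterLaurent m (LaurentSeries (LaurentSeries K))

namespace IterLaurent

instance instField : (m : ℕ) → (K : Type u) → [Field K] → Field (IterLaurent m K)
  | 0, _, h => h
  | m + 1, K, _ => instField m (LaurentSeries (LaurentSeries K))

/-- The embedding of the field of constants `K`. -/
def const : (m : ℕ) → (K : Type u) → [Field K] → (K →+* IterLaurent m K)
  | 0, K, _ => RingHom.id K
  | m + 1, K, _ => (const m (LaurentSeries (LaurentSeries K))).comp
      ((HahnSeries.C : LaurentSeries K →+* LaurentSeries (LaurentSeries K)).comp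
        (HahnSeries.C : K →+* LaurentSeries K))

/-- The element `αᵢ`, the inverse of the Laurent series variable `αᵢ⁻¹`. -/
def alpha : (m : ℕ) → (K : Type u) → [Field K] → Fin m → IterLaurent m K
  | 0, _, _ => Fin.elim0
  | m + 1, K, _ => Fin.cons
      (const m (LaurentSeries (LaurentSeries K))
        (HahnSeries.C (HahnSeries.single (-1 : ℤ) (1 : K) : LaurentSeries K)))
      (alpha m (LaurentSeries (LaurentSeries K)))

/-- The element `βᵢ`, the inverse of the Laurent series variable `βᵢ⁻¹`. -/
def beta : (m : ℕ) → (K : Type u) → [Field K] → Fin m → IterLaurent m K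
  | 0, _, _ => Fin.elim0
  | m + 1, K, _ => Fin.cons
      (const m (LaurentSeries (LaurentSeries K))
        (HahnSeries.single (-1 : ℤ) (1 : LaurentSeries K)))
      (beta m (LaurentSeries (LaurentSeries K)))

end IterLaurent

end

/-!
The field `F` carries a valuation, trivial on constants, for which the `αᵢ` and `βᵢ` have
independent negative values. It extends to a valuation of `A` for which the monomials in the symbol
generators form a splitting basis; their values represent distinct classes modulo the values of
`F`, and these classes form the group `G = (ℤ/p)^{2m}`. Hence `dim V` is at most the number of
classes of values of elements of `V`. The reduced trace is a constant multiple of the coordinate at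
a single monomial, of class `g₀` say.

Let `a, b ∈ V` have leading terms which commute. Polarising `Tr ((a + c b)^{p-1}) = 0` by a
Vandermonde argument annihilates each component of bidegree `(i, j)` with `i + j = p - 1`, and the
leading term of this component is that of `binom(p-1, j) aⁱ bʲ`, where `binom(p-1, j) ≠ 0`. So the
classes `s, t` of `a, b` satisfy `i s + j t ≠ g₀`. If two of the translates `s + g₀` spanned the
same line of `G` over `𝔽_p`, or if one of them vanished, some `i, j` would violate this. Leading
terms always commute when `char F₀ = p`, while otherwise `g₀ = 0` and they commute when the classes
are proportional. Thus there are at most as many classes as lines, `(p^{2m} - 1) / (p - 1)`.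
-/

noncomputable section

open Module (Basis)

section LeadingCommute

variable {A M : Type*} [Ring A] [LinearOrderedAddCommMonoidWithTop M] {w : AddValuation A M}
  {a a' b c : A}

/-- `a` and `b` commute up to terms of higher value, i.e. their leading terms commute in the graded
ring of the valuation `w`. The strict inequality forces both values to be finite. -/
def LeadingCommute (w : AddValuation A M) (a b : A) : Prop :=
  w a + w b < w (a * b - b * a)

namespace LeadingCommute

theorem left_ne_top (h : LeadingCommute w a b) : w a ≠ ⊤ := by
  intro ha
  simp [LeadingCommute, ha] at h

protected theorem symm (h : LeadingCommute w a b) : LeadingCommute w b a := by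
  rwa [LeadingCommute, add_comm, w.map_sub_swap]

theorem right_ne_top (h : LeadingCommute w a b) : w b ≠ ⊤ :=
  h.symm.left_ne_top

theorem of_commute (h : Commute a b) (ha : w a ≠ ⊤) (hb : w b ≠ ⊤) : LeadingCommute w a b := by
  rw [LeadingCommute, h.eq, sub_self, w.map_zero, lt_top_iff_ne_top]
  exact fun htop => hb (add_right_injective_of_ne_top _ ha (by simpa using htop))

theorem mul_right (hb : LeadingCommute w a b) (hc : LeadingCommute w a c) :
    LeadingCommute w a (b * c) := by
  have split : a * (b * c) - b * c * a = (a * b - b * a) * c + b * (a * c - c * a) := by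
    noncomm_ring
  rw [LeadingCommute, split]
  apply w.map_lt_add
  · rw [w.map_mul, w.map_mul, ← add_assoc]
    exact (add_lt_add_iff_left_of_ne_top hc.right_ne_top).2 hb
  · rw [w.map_mul, w.map_mul, add_left_comm]
    exact (add_lt_add_iff_right_of_ne_top hb.right_ne_top).2 hc

theorem mul_left (ha : LeadingCommute w a c) (hb : LeadingCommute w b c) :
    LeadingCommute w (a * b) c :=
  (ha.symm.mul_right hb.symm).symm

theorem pow_right (h : LeadingCommute w a b) : ∀ n, LeadingCommute w a (b ^ n)
  | 0 => by
    rw [pow_zero]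
    refine of_commute (.one_right a) h.left_ne_top fun h1 => h.left_ne_top ?_
    rw [← one_mul a, w.map_mul, h1, top_add]
  | n + 1 => by
    rw [pow_succ]
    exact (h.pow_right n).mul_right h

theorem pow_left (h : LeadingCommute w a b) (n : ℕ) : LeadingCommute w (a ^ n) b :=
  (h.symm.pow_right n).symm

theorem congr_left (h : LeadingCommute w a b) (ha : w a < w (a' - a)) :
    LeadingCommute w a' b := by
  have split : a' * b - b * a' = (a * b - b * a) + ((a' - a) * b - b * (a' - a)) := by
    noncomm_ring
  have hdiff : w a + w b < w (a' - a) + w b :=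
    (add_lt_add_iff_left_of_ne_top h.right_ne_top).2 ha
  rw [LeadingCommute, w.map_eq_of_lt_sub ha, split]
  refine w.map_lt_add h (hdiff.trans_le (w.map_le_sub ?_ ?_))
  · rw [w.map_mul]
  · rw [w.map_mul, add_comm]

theorem congr_right (h : LeadingCommute w a b) {b' : A} (hb : w b < w (b' - b)) :
    LeadingCommute w a b' :=
  (h.symm.congr_left hb).symm

theorem smul_left {F : Type*} [Field F] [Algebra F A] (h : LeadingCommute w a b) {c : F}
    (hc : w (algebraMap F A c) ≠ ⊤) : LeadingCommute w (c • a) b := by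
  rw [Algebra.smul_def]
  exact (of_commute (Algebra.commutes c b) hc h.right_ne_top).mul_left h

end LeadingCommute

theorem le_map_nsmul (w : AddValuation A M) (n : ℕ) (a : A) : w a ≤ w (n • a) := by
  simpa using w.map_le_sum (s := Finset.range n) (f := fun _ => a) fun _ _ => le_rfl

end LeadingCommute

section WordSum

open Finset.HasAntidiagonal (antidiagonal)

/-- The sum of all words in `i` letters `a` and `j` letters `b`: the component of bidegree `(i, j)`
of `(a + b) ^ (i + j)` when `a` and `b` do not commute. -/
def wordSum {A : Type*} [Semiring A] (a b : A) : ℕ → ℕ → A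
  | 0, 0 => 1
  | i + 1, 0 => a * wordSum a b i 0
  | 0, j + 1 => b * wordSum a b 0 j
  | i + 1, j + 1 => a * wordSum a b i (j + 1) + b * wordSum a b (i + 1) j

variable {A : Type*}

theorem wordSum_zero_right [Semiring A] (a b : A) : ∀ i, wordSum a b i 0 = a ^ i
  | 0 => by rw [wordSum, pow_zero]
  | i + 1 => by rw [wordSum, wordSum_zero_right a b i, pow_succ']

theorem wordSum_zero_left [Semiring A] (a b : A) : ∀ j, wordSum a b 0 j = b ^ j
  | 0 => by rw [wordSum, pow_zero]
  | j + 1 => by rw [wordSum, wordSum_zero_left a b j, pow_succ']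

theorem add_pow_eq_sum_wordSum [Semiring A] (a b : A) (n : ℕ) :
    (a + b) ^ n = ∑ ij ∈ antidiagonal n, wordSum a b ij.1 ij.2 := by
  induction n with
  | zero => simp [wordSum]
  | succ n ih =>
    let startA (ij : ℕ × ℕ) : A := ij.1.casesOn 0 fun i => a * wordSum a b i ij.2
    let startB (ij : ℕ × ℕ) : A := ij.2.casesOn 0 fun j => b * wordSum a b ij.1 j
    have first_letter : ∀ ij ∈ antidiagonal (n + 1),
        wordSum a b ij.1 ij.2 = startA ij + startB ij := by
      rintro ⟨_ | i, _ | j⟩ hij <;> simp_all [wordSum, startA, startB]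
    rw [Finset.sum_congr rfl first_letter, Finset.sum_add_distrib,
      Finset.Nat.sum_antidiagonal_succ (f := startA),
      Finset.Nat.sum_antidiagonal_succ' (f := startB), pow_succ', ih, add_mul, Finset.mul_sum,
      Finset.mul_sum]
    simp [startA, startB]

theorem wordSum_smul_right {R : Type*} [CommSemiring R] [Semiring A] [Algebra R A] (a b : A)
    (c : R) (i j : ℕ) : wordSum a (c • b) i j = c ^ j • wordSum a b i j := by
  induction i, j using wordSum.induct with
  | case1 => simp [wordSum]
  | case2 i ih => simp [wordSum, ih]
  | case3 j ih => simp [wordSum, ih, smul_smul, pow_succ]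
  | case4 i j iha ihb => simp [wordSum, iha, ihb, smul_smul, pow_succ]

theorem injective_cast_of_factorial_ne_zero {F : Type*} [Ring F] {n : ℕ}
    (hn : (n.factorial : F) ≠ 0) :
    Function.Injective fun k : Fin (n + 1) => ((k : ℕ) : F) := by
  refine .of_lt_imp_ne fun k l hkl heq => hn ?_
  have hdvd : (l - k : ℕ) ∣ n.factorial := Nat.dvd_factorial (by omega) (by omega)
  obtain ⟨d, hd⟩ := hdvd
  rw [hd, Nat.cast_mul, Nat.cast_sub hkl.le, heq, sub_self, zero_mul]

theorem map_wordSum_eq_zero {F : Type*} [Field F] [Ring A] [Algebra F A] (T : A →ₗ[F] F) {a b : A}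
    {n : ℕ} (hn : (n.factorial : F) ≠ 0) (hT : ∀ c : F, T ((a + c • b) ^ n) = 0) {i j : ℕ}
    (hij : i + j = n) : T (wordSum a b i j) = 0 := by
  have vandermonde : ∀ k : Fin (n + 1),
      ∑ l : Fin (n + 1), ((k : ℕ) : F) ^ (l : ℕ) * T (wordSum a b (n - l) l) = 0 := by
    intro k
    rw [← hT (k : ℕ), add_pow_eq_sum_wordSum, ← Finset.Nat.sum_antidiagonal_swap,
      Finset.Nat.sum_antidiagonal_eq_sum_range_succ_mk, Finset.sum_range, map_sum]
    simp [wordSum_smul_right]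
  have hzero := congrFun (Matrix.eq_zero_of_forall_index_sum_pow_mul_eq_zero
    (injective_cast_of_factorial_ne_zero hn) vandermonde) ⟨j, by omega⟩
  simpa [← hij] using hzero

variable {M : Type*} [Ring A] [LinearOrderedAddCommMonoidWithTop M] {w : AddValuation A M}

/-- The leading term of `wordSum` is the one given by the commutative binomial theorem. -/
theorem LeadingCommute.lt_map_wordSum_sub {a b : A} (h : LeadingCommute w a b) (i j : ℕ) :
    w (a ^ i * b ^ j) < w (wordSum a b i j - (i + j).choose j • (a ^ i * b ^ j)) := by
  have ne_top (i j : ℕ) : w (a ^ i * b ^ j) ≠ ⊤ := by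
    rw [w.map_mul]
    exact ne_top_of_lt ((h.pow_left i).pow_right j)
  induction i, j using wordSum.induct with
  | case1 => simpa [wordSum] using (ne_top 0 0).lt_top
  | case2 i => simpa [wordSum_zero_right] using (ne_top (i + 1) 0).lt_top
  | case3 j => simpa [wordSum_zero_left] using (ne_top 0 (j + 1)).lt_top
  | case4 i j iha ihb =>
    have split : wordSum a b (i + 1) (j + 1) -
          (i + 1 + (j + 1)).choose (j + 1) • (a ^ (i + 1) * b ^ (j + 1)) =
        a * (wordSum a b i (j + 1) - (i + (j + 1)).choose (j + 1) • (a ^ i * b ^ (j + 1))) +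
        (b * (wordSum a b (i + 1) j - (i + 1 + j).choose j • (a ^ (i + 1) * b ^ j)) +
        (i + 1 + j).choose j • ((b * a ^ (i + 1) - a ^ (i + 1) * b) * b ^ j)) := by
      rw [wordSum, show i + 1 + (j + 1) = i + (j + 1) + 1 by ring, Nat.choose_succ_succ',
        show i + 1 + j = i + (j + 1) by ring, add_smul]
      simp only [mul_sub, sub_mul, smul_sub, mul_smul_comm, pow_succ', mul_assoc]
      abel
    rw [split]
    refine w.map_lt_add ?_ (w.map_lt_add ?_ ?_)
    · rw [pow_succ', mul_assoc, w.map_mul, w.map_mul a]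
      exact (add_lt_add_iff_right_of_ne_top h.left_ne_top).2 iha
    · rw [pow_succ' b, w.map_mul, w.map_mul b, w.map_mul b, add_left_comm, ← w.map_mul]
      exact (add_lt_add_iff_right_of_ne_top h.right_ne_top).2 ihb
    · refine lt_of_lt_of_le ?_ (le_map_nsmul w _ _)
      rw [pow_succ' b, ← mul_assoc, w.map_mul, w.map_mul, w.map_mul _ (b ^ j), add_comm (w _) (w b)]
      exact (add_lt_add_iff_left_of_ne_top (h.pow_right j).right_ne_top).2 (h.pow_left _).symm

end WordSum

section Gauge

variable {F A Γ ι : Type*} [Field F] [Ring A] [Algebra F A] [AddCommGroup Γ] [LinearOrder Γ]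
  [IsOrderedAddMonoid Γ] [Fintype ι] {v : AddValuation F (WithTop Γ)} {B : Basis ι F A} {ω : ι → Γ}

/-- The value function `∑ g, c g • B g ↦ min (v (c g) + ω g)` on an algebra over a valued field: the
norm in the sense of Tignol and Wadsworth for which `B` is a splitting basis whose members have the
prescribed values `ω`. -/
def splitNorm (v : AddValuation F (WithTop Γ)) (B : Basis ι F A) (ω : ι → Γ) (a : A) : WithTop Γ :=
  Finset.univ.inf fun g => v (B.repr a g) + ω g

theorem splitNorm_le (a : A) (g : ι) : splitNorm v B ω a ≤ v (B.repr a g) + ω g :=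
  Finset.inf_le (Finset.mem_univ g)

theorem le_splitNorm_iff {a : A} {δ : WithTop Γ} :
    δ ≤ splitNorm v B ω a ↔ ∀ g, δ ≤ v (B.repr a g) + ω g := by
  simp [splitNorm]

theorem lt_splitNorm_iff {a : A} {δ : WithTop Γ} (hδ : δ ≠ ⊤) :
    δ < splitNorm v B ω a ↔ ∀ g, δ < v (B.repr a g) + ω g := by
  simp [splitNorm, Finset.lt_inf_iff hδ.lt_top]

theorem splitNorm_zero : splitNorm v B ω 0 = ⊤ := by
  simp [splitNorm]

theorem splitNorm_ne_top {a : A} (ha : a ≠ 0) : splitNorm v B ω a ≠ ⊤ := by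
  obtain ⟨g, hg⟩ : ∃ g, B.repr a g ≠ 0 := by
    by_contra! h
    exact ha (B.repr.map_eq_zero_iff.1 (Finsupp.ext h))
  exact ne_top_of_le_ne_top (WithTop.add_ne_top.2 ⟨v.ne_top_iff.2 hg, WithTop.coe_ne_top⟩)
    (splitNorm_le a g)

theorem exists_splitNorm_eq [Nonempty ι] (a : A) :
    ∃ g, splitNorm v B ω a = v (B.repr a g) + ω g := by
  obtain ⟨g, -, hg⟩ := Finset.exists_mem_eq_inf Finset.univ Finset.univ_nonempty
    fun g => v (B.repr a g) + ω g
  exact ⟨g, hg⟩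

theorem splitNorm_basis (g : ι) : splitNorm v B ω (B g) = ω g := by
  classical
  apply le_antisymm
  · simpa using splitNorm_le (v := v) (B := B) (ω := ω) (B g) g
  · refine le_splitNorm_iff.2 fun h => ?_
    by_cases hgh : g = h <;> simp [hgh]

theorem splitNorm_smul (c : F) (a : A) : splitNorm v B ω (c • a) = v c + splitNorm v B ω a := by
  have hmono : Monotone (v c + ·) := add_right_mono
  rw [splitNorm, splitNorm, Finset.apply_inf_eq_inf_comp_of_linearOrder _ hmono (add_top _)]
  exact Finset.inf_congr rfl fun g _ => by simp [add_assoc]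

theorem splitNorm_neg (a : A) : splitNorm v B ω (-a) = splitNorm v B ω a := by
  simp [splitNorm]

theorem le_splitNorm_add {a b : A} {δ : WithTop Γ} (ha : δ ≤ splitNorm v B ω a)
    (hb : δ ≤ splitNorm v B ω b) : δ ≤ splitNorm v B ω (a + b) := by
  rw [le_splitNorm_iff] at *
  intro g
  rw [map_add, Finsupp.add_apply]
  exact ((le_min (ha g) (hb g)).trans (min_add_add_right _ _ _).le).trans
    (add_le_add_left (v.map_add _ _) _)

theorem le_splitNorm_sum {κ : Type*} {s : Finset κ} {f : κ → A} {δ : WithTop Γ}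
    (h : ∀ k ∈ s, δ ≤ splitNorm v B ω (f k)) : δ ≤ splitNorm v B ω (∑ k ∈ s, f k) :=
  Finset.sum_induction f (δ ≤ splitNorm v B ω ·) (fun _ _ => le_splitNorm_add)
    (by simp [splitNorm_zero]) h

theorem splitNorm_eq_of_lt_sub {a b : A} (h : splitNorm v B ω a < splitNorm v B ω (b - a)) :
    splitNorm v B ω b = splitNorm v B ω a := by
  apply le_antisymm
  · by_contra! hlt
    have hmin : min (splitNorm v B ω b) (splitNorm v B ω (b - a)) ≤
        splitNorm v B ω (b + -(b - a)) :=
      le_splitNorm_add (min_le_left _ _) ((min_le_right _ _).trans_eq (splitNorm_neg _).symm)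
    rw [neg_sub, add_sub_cancel] at hmin
    exact (lt_min hlt h).not_ge hmin
  · simpa using le_splitNorm_add le_rfl h.le

theorem add_le_splitNorm_map {f : A →ₗ[F] A} {γ : WithTop Γ}
    (hf : ∀ g, γ + ω g ≤ splitNorm v B ω (f (B g))) (a : A) :
    γ + splitNorm v B ω a ≤ splitNorm v B ω (f a) := by
  conv_rhs => rw [← B.sum_repr a, map_sum]
  refine le_splitNorm_sum fun g _ => ?_
  rw [map_smul, splitNorm_smul]
  calc γ + splitNorm v B ω a
      ≤ γ + (v (B.repr a g) + ω g) := add_le_add_right (splitNorm_le a g) _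
    _ = v (B.repr a g) + (γ + ω g) := add_left_comm _ _ _
    _ ≤ _ := add_le_add_right (hf g) _

theorem add_le_splitNorm_mul
    (hB : ∀ g h, (ω g + ω h : WithTop Γ) ≤ splitNorm v B ω (B g * B h)) (a b : A) :
    splitNorm v B ω a + splitNorm v B ω b ≤ splitNorm v B ω (a * b) := by
  refine add_le_splitNorm_map (f := LinearMap.mulLeft F a) (fun h => ?_) b
  rw [add_comm]
  refine add_le_splitNorm_map (f := LinearMap.mulRight F (B h)) (fun g => ?_) a
  rw [add_comm]
  exact hB g h

end Gauge

section Armature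

variable {F A Γ G : Type*} [Field F] [Ring A] [Algebra F A] [AddCommGroup Γ] [LinearOrder Γ]
  [IsOrderedAddMonoid Γ] [AddCommGroup G] [Fintype G] {v : AddValuation F (WithTop Γ)}
  {B : Basis G F A} {ω : G → Γ} {π : Γ →+ G} {a b : A} {α β : Γ}

/-- A basis whose members have values in pairwise distinct classes modulo the value group of the
base field, and whose products have the expected values. The class group is `G`, which also indexes
the basis; `π` maps a value to its class. -/
structure IsArmature (v : AddValuation F (WithTop Γ)) (B : Basis G F A) (ω : G → Γ) (π : Γ →+ G) :
    Prop where
  splitNorm_one : splitNorm v B ω 1 = 0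
  splitNorm_mul_basis (g h : G) : splitNorm v B ω (B g * B h) = ω g + ω h
  class_scalar {c : F} {γ : Γ} (hc : v c = γ) : π γ = 0
  class_index (g : G) : π (ω g) = g

namespace IsArmature

theorem class_eq_of_value_eq (H : IsArmature v B ω π) {c : F} {g : G} {γ : Γ}
    (h : v c + ω g = γ) : π γ = g := by
  obtain ⟨δ, ε, hδ, hε, hsum⟩ := WithTop.add_eq_coe.1 h
  rw [WithTop.coe_inj] at hε
  rw [← hsum, map_add, H.class_scalar hδ.symm, hε, H.class_index, zero_add]

theorem exists_leading_term (H : IsArmature v B ω π) (ha : a ≠ 0) :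
    ∃ g, ∃ c : F, c ≠ 0 ∧ splitNorm v B ω (c • B g) < splitNorm v B ω (a - c • B g) := by
  classical
  obtain ⟨g, hval⟩ := exists_splitNorm_eq (v := v) (B := B) (ω := ω) a
  have hg : B.repr a g ≠ 0 := fun h0 => splitNorm_ne_top ha (by rw [hval, h0, v.map_zero, top_add])
  refine ⟨g, _, hg, ?_⟩
  rw [splitNorm_smul, splitNorm_basis, ← hval, lt_splitNorm_iff (splitNorm_ne_top ha)]
  intro h
  obtain rfl | hgh := eq_or_ne g h
  · simpa using (splitNorm_ne_top ha).lt_top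
  · have hrepr : B.repr (a - B.repr a g • B g) h = B.repr a h := by simp [hgh]
    rw [hrepr]
    refine (splitNorm_le a h).lt_of_ne fun heq => hgh ?_
    obtain ⟨γ, hγ⟩ := WithTop.ne_top_iff_exists.1 (splitNorm_ne_top (v := v) (ω := ω) (B := B) ha)
    rw [← H.class_eq_of_value_eq (hval.symm.trans hγ.symm),
      H.class_eq_of_value_eq (heq.symm.trans hγ.symm)]

theorem splitNorm_mul (H : IsArmature v B ω π) (a b : A) :
    splitNorm v B ω (a * b) = splitNorm v B ω a + splitNorm v B ω b := by
  obtain rfl | ha := eq_or_ne a 0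
  · simp [splitNorm_zero]
  obtain rfl | hb := eq_or_ne b 0
  · simp [splitNorm_zero]
  obtain ⟨g, c, -, hga⟩ := H.exists_leading_term ha
  obtain ⟨h, d, -, hhb⟩ := H.exists_leading_term hb
  have hag := splitNorm_eq_of_lt_sub hga
  have hbh := splitNorm_eq_of_lt_sub hhb
  have leading_value : splitNorm v B ω (c • B g * d • B h) =
      splitNorm v B ω a + splitNorm v B ω b := by
    rw [hag, hbh, smul_mul_smul_comm, splitNorm_smul, splitNorm_smul, splitNorm_smul,
      splitNorm_basis, splitNorm_basis, H.splitNorm_mul_basis, v.map_mul, add_add_add_comm]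
  rw [← leading_value]
  apply splitNorm_eq_of_lt_sub
  have split : a * b - c • B g * d • B h = (a - c • B g) * b + c • B g * (b - d • B h) := by
    noncomm_ring
  rw [leading_value, split]
  have le_mul := add_le_splitNorm_mul fun g h => (H.splitNorm_mul_basis g h).ge
  refine (lt_min ?_ ?_).trans_le (le_splitNorm_add (min_le_left _ _) (min_le_right _ _))
  · refine lt_of_lt_of_le ?_ (le_mul _ b)
    exact (add_lt_add_iff_left_of_ne_top (splitNorm_ne_top hb)).2 (hag.trans_lt hga)
  · refine lt_of_lt_of_le ?_ (le_mul _ (b - d • B h))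
    rw [← hag]
    exact (add_lt_add_iff_right_of_ne_top (splitNorm_ne_top ha)).2 (hbh.trans_lt hhb)

/-- The valuation on the algebra given by an armature: its norm is multiplicative because the
leading terms of two elements multiply to a leading term. -/
def valuation (H : IsArmature v B ω π) : AddValuation A (WithTop Γ) :=
  .of (splitNorm v B ω) splitNorm_zero H.splitNorm_one
    (fun _ _ => le_splitNorm_add (min_le_left _ _) (min_le_right _ _)) H.splitNorm_mul

theorem valuation_smul (H : IsArmature v B ω π) (c : F) (a : A) :
    H.valuation (c • a) = v c + H.valuation a :=
  splitNorm_smul c a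

theorem valuation_basis (H : IsArmature v B ω π) (g : G) : H.valuation (B g) = ω g :=
  splitNorm_basis g

theorem valuation_algebraMap (H : IsArmature v B ω π) (c : F) :
    H.valuation (algebraMap F A c) = v c := by
  rw [Algebra.algebraMap_eq_smul_one, valuation_smul, AddValuation.map_one, add_zero]

theorem exists_valuation_eq_coe (H : IsArmature v B ω π) (ha : a ≠ 0) :
    ∃ α : Γ, H.valuation a = α :=
  (WithTop.ne_top_iff_exists.1 (splitNorm_ne_top ha)).imp fun _ => Eq.symm

theorem repr_class_ne_zero (H : IsArmature v B ω π) (ha : H.valuation a = α) :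
    B.repr a (π α) ≠ 0 := by
  obtain ⟨g, hg⟩ := exists_splitNorm_eq (v := v) (B := B) (ω := ω) a
  have hval : v (B.repr a g) + ω g = α := hg.symm.trans ha
  rw [H.class_eq_of_value_eq hval]
  rintro h0
  simp [h0] at hval

theorem leadingCommute_smul_left (H : IsArmature v B ω π) {c : F} (hc : c ≠ 0)
    (h : LeadingCommute H.valuation a b) : LeadingCommute H.valuation (c • a) b :=
  h.smul_left (by rw [H.valuation_algebraMap]; exact v.ne_top_iff.2 hc)

theorem leadingCommute_of_basis (H : IsArmature v B ω π)
    (hB : ∀ g h, LeadingCommute H.valuation (B g) (B h)) (ha : a ≠ 0) (hb : b ≠ 0) :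
    LeadingCommute H.valuation a b := by
  obtain ⟨g, c, hc, hga⟩ := H.exists_leading_term ha
  obtain ⟨h, d, hd, hhb⟩ := H.exists_leading_term hb
  have leading := H.leadingCommute_smul_left hc (H.leadingCommute_smul_left hd (hB g h).symm).symm
  exact (leading.congr_left hga).congr_right hhb

theorem exists_smul_lt_sub_of_class_eq (H : IsArmature v B ω π) (ha : H.valuation a = α)
    (hb : H.valuation b = β) (hαβ : π α = π β) :
    ∃ c : F, c ≠ 0 ∧ H.valuation (c • a) < H.valuation (b - c • a) := by
  have leading {x : A} {ξ : Γ} (hx : H.valuation x = ξ) :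
      ∃ d : F, d ≠ 0 ∧ H.valuation (d • B (π ξ)) = H.valuation x ∧
        H.valuation x < H.valuation (x - d • B (π ξ)) := by
    obtain ⟨g, d, hd, hlt⟩ := H.exists_leading_term (a := x) (by rintro rfl; simp at hx)
    have hval : H.valuation x = H.valuation (d • B g) := H.valuation.map_eq_of_lt_sub hlt
    obtain rfl : π ξ = g := H.class_eq_of_value_eq (c := d) (by
      rw [← hx, hval, valuation_smul, valuation_basis])
    exact ⟨d, hd, hval.symm, hval.trans_lt hlt⟩
  obtain ⟨d, hd, hda, hlta⟩ := leading ha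
  obtain ⟨e, he, heb, hltb⟩ := leading hb
  have hsmul : (e / d) • d • B (π α) = e • B (π β) := by
    rw [smul_smul, div_mul_cancel₀ e hd, hαβ]
  have hval : H.valuation ((e / d) • a) = H.valuation b := by
    rw [valuation_smul, ← hda, ← valuation_smul, hsmul, heb]
  refine ⟨e / d, div_ne_zero he hd, ?_⟩
  have split : b - (e / d) • a = (b - e • B (π β)) - (e / d) • (a - d • B (π α)) := by
    rw [smul_sub, hsmul]
    abel
  rw [hval, split]
  refine (lt_min hltb ?_).trans_le (H.valuation.map_sub _ _)
  rw [← hval, valuation_smul, valuation_smul]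
  exact (add_lt_add_iff_right_of_ne_top (v.ne_top_iff.2 (div_ne_zero he hd))).2 hlta

theorem leadingCommute_of_class_eq_nsmul (H : IsArmature v B ω π) (ha : H.valuation a = α)
    (hb : H.valuation b = β) {k : ℕ} (hk : π β = k • π α) : LeadingCommute H.valuation a b := by
  obtain ⟨c, hc, hlt⟩ := H.exists_smul_lt_sub_of_class_eq (a := a ^ k) (α := k • α)
    (by rw [AddValuation.map_pow, ha, WithTop.coe_nsmul]) hb (by rw [hk, map_nsmul])
  have comm_self : LeadingCommute H.valuation a a :=
    .of_commute (.refl a) (by simp [ha]) (by simp [ha])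
  exact (H.leadingCommute_smul_left hc (comm_self.pow_right k).symm).symm.congr_right hlt

end IsArmature

end Armature

section RankBound

theorem exists_nsmul_add_nsmul_eq {p : ℕ} [Fact p.Prime] {G : Type*} [AddCommGroup G]
    [Module (ZMod p) G] {g s t : G} {k : ZMod p} (hk : t + g = k • (s + g)) (hst : s ≠ t) :
    ∃ i j : ℕ, i + j = p - 1 ∧ i • s + j • t = g := by
  have hk₁ : 1 - k ≠ 0 := by
    rintro hk₁
    rw [← sub_eq_zero.1 hk₁, one_smul, add_left_inj] at hk
    exact hst hk.symm
  set z : ZMod p := k / (1 - k)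
  have hp := (Fact.out : p.Prime).one_lt
  have hz := z.val_lt
  have hzk : z + (-1 - z) * k = 0 := by
    simp only [z]
    field_simp
    ring
  refine ⟨z.val, p - 1 - z.val, by omega, ?_⟩
  have cast_sub : ((p - 1 - z.val : ℕ) : ZMod p) = -1 - z := by
    rw [Nat.cast_sub (by omega), Nat.cast_sub hp.le, ZMod.natCast_zmod_val]
    simp
  rw [← Nat.cast_smul_eq_nsmul (ZMod p), ← Nat.cast_smul_eq_nsmul (ZMod p), cast_sub,
    ZMod.natCast_zmod_val]
  calc z • s + (-1 - z) • t = z • (s + g) + (-1 - z) • (t + g) + g := by module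
    _ = (z + (-1 - z) * k) • (s + g) + g := by rw [hk]; module
    _ = g := by rw [hzk, zero_smul, zero_add]

namespace IsArmature

variable {F A Γ G : Type*} [Field F] [Ring A] [Algebra F A] [AddCommGroup Γ] [LinearOrder Γ]
  [IsOrderedAddMonoid Γ] [AddCommGroup G] [Fintype G] {v : AddValuation F (WithTop Γ)}
  {B : Basis G F A} {ω : G → Γ} {π : Γ →+ G} {a b : A} {α β : Γ} {V : Submodule F A} {g₀ : G}

/-- The classes modulo `v F` of the values taken on `V`. -/
def valueClasses (H : IsArmature v B ω π) (V : Submodule F A) : Set G :=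
  {g | ∃ a ∈ V, ∃ α : Γ, H.valuation a = α ∧ π α = g}

theorem finrank_le_card_valueClasses (H : IsArmature v B ω π) (V : Submodule F A) :
    Module.finrank F V ≤ Nat.card (H.valueClasses V) := by
  classical
  let coords : V →ₗ[F] (H.valueClasses V → F) :=
    (LinearMap.pi fun g : H.valueClasses V => B.coord g).comp V.subtype
  have hcoords : Function.Injective coords := by
    refine (injective_iff_map_eq_zero _).2 fun a ha => ?_
    by_contra ha₀
    obtain ⟨α, hα⟩ := H.exists_valuation_eq_coe (by simpa using ha₀ : (a : A) ≠ 0)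
    exact H.repr_class_ne_zero hα (congrFun ha ⟨π α, a, a.2, α, hα, rfl⟩)
  have := LinearMap.finrank_le_finrank_of_injective hcoords
  rwa [Module.finrank_fintype_fun_eq_card, ← Nat.card_eq_fintype_card] at this

/-- If `i • π α + j • π β = g₀`, the leading term of `wordSum a b i j` would have a nonzero
coordinate at `g₀`. -/
theorem nsmul_class_add_nsmul_class_ne (H : IsArmature v B ω π) {n : ℕ}
    (hn : (n.factorial : F) ≠ 0) (hv : ∀ k : ℕ, (k : F) ≠ 0 → v k = 0)
    (hpow : ∀ c : F, B.repr ((a + c • b) ^ n) g₀ = 0) (hab : LeadingCommute H.valuation a b)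
    (ha : H.valuation a = α) (hb : H.valuation b = β) {i j : ℕ} (hij : i + j = n) :
    i • π α + j • π β ≠ g₀ := by
  have hchoose : ((i + j).choose j : F) ≠ 0 := by
    rw [← hij, ← Nat.add_choose_mul_factorial_mul_factorial] at hn
    push_cast at hn
    exact left_ne_zero_of_mul (left_ne_zero_of_mul hn)
  have hvalue : H.valuation (wordSum a b i j) = (i • α + j • β : Γ) := by
    have hterm : H.valuation ((i + j).choose j • (a ^ i * b ^ j)) =
        H.valuation (a ^ i * b ^ j) := by
      rw [← Nat.cast_smul_eq_nsmul F, valuation_smul, hv _ hchoose, zero_add]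
    rw [H.valuation.map_eq_of_lt_sub (hterm.trans_lt (hab.lt_map_wordSum_sub i j)), hterm,
      AddValuation.map_mul, AddValuation.map_pow, AddValuation.map_pow, ha, hb]
    norm_cast
  rintro rfl
  rw [← map_nsmul, ← map_nsmul, ← map_add] at hpow
  exact H.repr_class_ne_zero hvalue (map_wordSum_eq_zero (B.coord _) hn hpow hij)

open LinearAlgebra.Projectivization in
theorem rank_le_card_projectivization {p : ℕ} [Fact p.Prime] [Module (ZMod p) G]
    (H : IsArmature v B ω π) (hp : ((p - 1).factorial : F) ≠ 0)
    (hv : ∀ k : ℕ, (k : F) ≠ 0 → v k = 0)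
    (hg₀ : g₀ = 0 ∨ ∀ g h, LeadingCommute H.valuation (B g) (B h))
    (hV : ∀ a ∈ V, B.repr (a ^ (p - 1)) g₀ = 0) :
    Module.rank F V ≤ Nat.card (ℙ (ZMod p) G) := by
  have hcomb {a b : A} {α β : Γ} {i j : ℕ} (haV : a ∈ V) (hbV : b ∈ V) (ha : H.valuation a = α)
      (hb : H.valuation b = β) (hab : LeadingCommute H.valuation a b) (hij : i + j = p - 1) :
      i • π α + j • π β ≠ g₀ :=
    H.nsmul_class_add_nsmul_class_ne hp hv
      (fun c => hV _ (V.add_mem haV (V.smul_mem c hbV))) hab ha hb hij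
  have hne : ∀ s ∈ H.valueClasses V, s + g₀ ≠ 0 := by
    rintro _ ⟨a, haV, α, ha, rfl⟩ hsum
    have comm_self : LeadingCommute H.valuation a a :=
      .of_commute (.refl a) (by simp [ha]) (by simp [ha])
    refine hcomb haV haV ha ha comm_self (add_zero _) ?_
    rw [zero_nsmul, add_zero, ← Nat.cast_smul_eq_nsmul (ZMod p),
      Nat.cast_sub (Fact.out : p.Prime).one_le, ← neg_eq_of_add_eq_zero_right hsum]
    simp
  have hline : ∀ s ∈ H.valueClasses V, ∀ t ∈ H.valueClasses V, ∀ k : ZMod p,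
      t + g₀ = k • (s + g₀) → s = t := by
    rintro _ ⟨a, haV, α, ha, rfl⟩ _ ⟨b, hbV, β, hb, rfl⟩ k hk
    by_contra hst
    obtain ⟨i, j, hij, hsum⟩ := exists_nsmul_add_nsmul_eq hk hst
    refine hcomb haV hbV ha hb ?_ hij hsum
    obtain rfl | hB := hg₀
    · refine H.leadingCommute_of_class_eq_nsmul ha hb (k := k.val) ?_
      rw [← Nat.cast_smul_eq_nsmul (ZMod p), ZMod.natCast_zmod_val]
      simpa using hk
    · exact H.leadingCommute_of_basis hB (by rintro rfl; simp at ha) (by rintro rfl; simp at hb)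
  have hcard : Nat.card (H.valueClasses V) ≤ Nat.card (ℙ (ZMod p) G) := by
    refine Nat.card_le_card_of_injective
      (fun s : H.valueClasses V => Projectivization.mk (ZMod p) (s + g₀) (hne s s.2)) ?_
    intro s t hst
    obtain ⟨k, hk⟩ := (Projectivization.mk_eq_mk_iff' _ _ _ _ _).1 hst
    exact Subtype.ext (hline t t.2 s s.2 k hk.symm).symm
  have : Module.Finite F A := .of_basis B
  rw [← Module.finrank_eq_rank]
  exact_mod_cast (H.finrank_le_card_valueClasses V).trans hcard

end IsArmature

end RankBound

section SymbolPair

/-- `x` and `y` satisfy the relations `x ^ p = α + ε x`, `y ^ p = β`, `y x = (ρ x + ε) y`. With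
`ε = 0` these define `(α, β)_{p,F}`, with `ρ = ε = 1` they define `[α, β)_{p,F}`. -/
structure IsSymbolPair {F Q : Type*} [Field F] [Ring Q] [Algebra F Q] (p : ℕ) (ρ ε α β : F)
    (x y : Q) : Prop where
  x_pow : x ^ p = algebraMap F Q α + ε • x
  y_pow : y ^ p = algebraMap F Q β
  y_mul_x : y * x = (ρ • x + ε • 1) * y

/-- The monomial `x ^ j * y ^ k` of a symbol algebra, with exponents reduced to `{0, …, p - 1}` so
that the monomials are indexed by a group. -/
def symbolMonomial {Q : Type*} [Ring Q] {p : ℕ} (x y : Q) (g : ZMod p × ZMod p) : Q :=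
  x ^ g.1.val * y ^ g.2.val

theorem zmod_val_add_one {p : ℕ} [NeZero p] (j : ZMod p) :
    (j + 1).val = j.val + 1 ∨ j + 1 = 0 ∧ j.val + 1 = p := by
  obtain hj | hj := (Nat.succ_le_of_lt j.val_lt).lt_or_eq
  · refine .inl ?_
    conv_lhs => rw [← ZMod.natCast_zmod_val j, ← Nat.cast_succ, ZMod.val_cast_of_lt hj]
  · refine .inr ⟨?_, hj⟩
    rw [← ZMod.natCast_zmod_val j, ← Nat.cast_succ, hj, ZMod.natCast_self]

namespace IsSymbolPair

variable {F Q : Type*} [Field F] [Ring Q] [Algebra F Q] {p : ℕ} {ρ ε α β : F} {x y : Q}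

theorem y_mul_x_pow_mul (h : IsSymbolPair p ρ ε α β x y) (j : ℕ) (a : Q) :
    y * (x ^ j * a) = (ρ • x + ε • 1) ^ j * (y * a) := by
  have semiconj : SemiconjBy y x (ρ • x + ε • 1) := h.y_mul_x
  rw [← mul_assoc, semiconj.pow_right j, mul_assoc]

variable [NeZero p]

theorem x_mul_symbolMonomial (h : IsSymbolPair p ρ ε α β x y) (hp : 1 < p) (j k : ZMod p) :
    ((j + 1).val = j.val + 1 ∧
      x * symbolMonomial x y (j, k) = symbolMonomial x y (j + 1, k)) ∨
    (j.val + 1 = p ∧ x * symbolMonomial x y (j, k) =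
      α • symbolMonomial x y ((0 : ZMod p), k) + ε • symbolMonomial x y ((1 : ZMod p), k)) := by
  simp only [symbolMonomial, ← mul_assoc, ← pow_succ']
  obtain hj | ⟨-, hj⟩ := zmod_val_add_one j
  · exact .inl ⟨hj, by rw [hj]⟩
  · refine .inr ⟨hj, ?_⟩
    rw [hj, h.x_pow, ZMod.val_one'' hp.ne', ZMod.val_zero, pow_zero, one_mul, pow_one, add_mul,
      smul_mul_assoc, ← Algebra.smul_def]

theorem y_mul_symbolMonomial (h : IsSymbolPair p ρ ε α β x y) (j k : ZMod p) :
    ((k + 1).val = k.val + 1 ∧ y * symbolMonomial x y (j, k) =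
      (ρ • x + ε • 1) ^ j.val * symbolMonomial x y ((0 : ZMod p), k + 1)) ∨
    (k.val + 1 = p ∧ y * symbolMonomial x y (j, k) =
      (ρ • x + ε • 1) ^ j.val * β • symbolMonomial x y (0 : ZMod p × ZMod p)) := by
  simp only [symbolMonomial, h.y_mul_x_pow_mul, ← pow_succ', Prod.fst_zero, Prod.snd_zero,
    ZMod.val_zero, pow_zero, one_mul]
  obtain hk | ⟨-, hk⟩ := zmod_val_add_one k
  · exact .inl ⟨hk, by rw [hk]⟩
  · exact .inr ⟨hk, by rw [hk, h.y_pow, Algebra.algebraMap_eq_smul_one]⟩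

theorem span_symbolMonomial_eq_top (h : IsSymbolPair p ρ ε α β x y) (hp : 1 < p)
    (hxy : Algebra.adjoin F {x, y} = ⊤) :
    Submodule.span F (Set.range (symbolMonomial (p := p) x y)) = ⊤ := by
  set W := Submodule.span F (Set.range (symbolMonomial (p := p) x y))
  have mem_W (g : ZMod p × ZMod p) : symbolMonomial x y g ∈ W := Submodule.subset_span ⟨g, rfl⟩
  have hx : W ≤ W.comap (LinearMap.mulLeft F x) := by
    rw [Submodule.span_le]
    rintro _ ⟨⟨j, k⟩, rfl⟩
    change x * _ ∈ W
    obtain ⟨-, hj⟩ | ⟨-, hj⟩ := h.x_mul_symbolMonomial hp j k <;> rw [hj]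
    · exact mem_W _
    · exact W.add_mem (W.smul_mem _ (mem_W _)) (W.smul_mem _ (mem_W _))
  have hx_pow (j : ℕ) : ∀ a ∈ W, (ρ • x + ε • 1) ^ j * a ∈ W := by
    induction j with
    | zero => simp
    | succ j ih =>
      intro a ha
      rw [pow_succ, mul_assoc, add_mul, smul_one_mul, smul_mul_assoc]
      exact ih _ (W.add_mem (W.smul_mem _ (hx ha)) (W.smul_mem _ ha))
  have hy : W ≤ W.comap (LinearMap.mulLeft F y) := by
    rw [Submodule.span_le]
    rintro _ ⟨⟨j, k⟩, rfl⟩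
    change y * _ ∈ W
    obtain ⟨-, hk⟩ | ⟨-, hk⟩ := h.y_mul_symbolMonomial j k <;> rw [hk]
    · exact hx_pow _ _ (mem_W _)
    · exact hx_pow _ _ (W.smul_mem _ (mem_W _))
  have mul_mem (q : Q) : ∀ a ∈ W, q * a ∈ W := by
    have hq : q ∈ Algebra.adjoin F {x, y} := hxy ▸ Algebra.mem_top
    induction hq using Algebra.adjoin_induction with
    | mem q hq =>
      obtain rfl | rfl := hq
      exacts [fun a ha => hx ha, fun a ha => hy ha]
    | algebraMap r => exact fun a ha => by rw [← Algebra.smul_def]; exact W.smul_mem _ ha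
    | add q r _ _ hq hr => exact fun a ha => by rw [add_mul]; exact W.add_mem (hq a ha) (hr a ha)
    | mul q r _ _ hq hr => exact fun a ha => by rw [mul_assoc]; exact hq _ (hr a ha)
  have one_mem : (1 : Q) ∈ W := by simpa [symbolMonomial] using mem_W 0
  exact Submodule.eq_top_iff'.2 fun q => by simpa using mul_mem q 1 one_mem

end IsSymbolPair

end SymbolPair

section MatrixModel

variable {K : Type*} [Field K] {p : ℕ}

/-- The matrix `b • ∑ t, e_{t, t + 1}`, which together with a diagonal matrix models a split symbol
algebra. -/
def shiftMatrix (p : ℕ) (b : K) : Matrix (ZMod p) (ZMod p) K :=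
  Matrix.of fun i j => if j = i + 1 then b else 0

theorem shiftMatrix_apply (b : K) (i j : ZMod p) :
    shiftMatrix p b i j = if j = i + 1 then b else 0 :=
  rfl

variable [NeZero p]

theorem shiftMatrix_pow_apply (b : K) (n : ℕ) (i j : ZMod p) :
    (shiftMatrix p b ^ n) i j = if j = i + n then b ^ n else 0 := by
  induction n generalizing i with
  | zero => simp [Matrix.one_apply, eq_comm]
  | succ n ih =>
    simp only [pow_succ', Matrix.mul_apply, shiftMatrix_apply, ite_mul, zero_mul,
      Finset.sum_ite_eq', Finset.mem_univ, if_true]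
    rw [ih, mul_ite, mul_zero, Nat.cast_succ, add_comm (n : ZMod p), add_assoc]

theorem symbolMonomial_matrix_apply (d : ZMod p → K) (b : K) (g : ZMod p × ZMod p)
    (s t : ZMod p) :
    symbolMonomial (Matrix.diagonal d) (shiftMatrix p b) g s t =
      if t = s + g.2 then d s ^ g.1.val * b ^ g.2.val else 0 := by
  simp [symbolMonomial, Matrix.diagonal_pow, shiftMatrix_pow_apply]

theorem isSymbolPair_matrix {F : Type*} [Field F] [Algebra F K] {ρ ε α β : F} {d : ZMod p → K}
    {b : K} (hd_succ : ∀ t, d (t + 1) = ρ • d t + algebraMap F K ε)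
    (hd : ∀ t, d t ^ p = algebraMap F K α + ε • d t) (hb : b ^ p = algebraMap F K β) :
    IsSymbolPair p ρ ε α β (Matrix.diagonal d) (shiftMatrix p b) where
  x_pow := by
    ext s t
    obtain rfl | hst := eq_or_ne s t
    · simp [Matrix.diagonal_pow, Matrix.algebraMap_matrix_apply, hd]
    · simp [Matrix.diagonal_pow, Matrix.algebraMap_matrix_apply, hst]
  y_pow := by
    ext s t
    rw [shiftMatrix_pow_apply, Matrix.algebraMap_matrix_apply, hb]
    simp [eq_comm]
  y_mul_x := by
    ext s t
    have entry : ((ρ • Matrix.diagonal d + ε • 1) * shiftMatrix p b) s t =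
        (ρ • d s + algebraMap F K ε) * shiftMatrix p b s t := by
      rw [← Matrix.diagonal_one, ← Matrix.diagonal_smul, ← Matrix.diagonal_smul,
        Matrix.diagonal_add, Matrix.diagonal_mul]
      simp [Algebra.algebraMap_eq_smul_one]
    rw [entry, Matrix.mul_diagonal, shiftMatrix_apply]
    by_cases hst : t = s + 1
    · simp [hst, hd_succ, mul_comm]
    · simp [hst]

theorem trace_symbolMonomial (d : ZMod p → K) (b : K) (g : ZMod p × ZMod p) :
    (symbolMonomial (Matrix.diagonal d) (shiftMatrix p b) g).trace =
      if g.2 = 0 then ∑ t, d t ^ g.1.val else 0 := by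
  by_cases hg : g.2 = 0 <;> simp [Matrix.trace, symbolMonomial_matrix_apply, hg]

theorem eq_zero_of_forall_sum_pow_val_mul_eq_zero {d c : ZMod p → K}
    (hd : Function.Injective d) (h : ∀ t, ∑ j, d t ^ j.val * c j = 0) : c = 0 := by
  cases p with
  | zero => exact (NeZero.ne 0 rfl).elim
  | succ n => exact Matrix.eq_zero_of_forall_index_sum_pow_mul_eq_zero hd h

theorem linearIndependent_symbolMonomial_matrix {d : ZMod p → K} (hd : Function.Injective d)
    {b : K} (hb : b ≠ 0) :
    LinearIndependent K (symbolMonomial (p := p) (Matrix.diagonal d) (shiftMatrix p b)) := by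
  refine Fintype.linearIndependent_iff.2 fun c hc => ?_
  have vandermonde (k t : ZMod p) : ∑ j, d t ^ j.val * c (j, k) = 0 := by
    have hentry := congrFun (congrFun hc t) (t + k)
    simp only [Matrix.sum_apply, Matrix.smul_apply, symbolMonomial_matrix_apply, smul_eq_mul,
      add_right_inj, mul_ite, mul_zero, Fintype.sum_prod_type, Finset.sum_ite_eq,
      Finset.mem_univ, if_true, Matrix.zero_apply] at hentry
    refine (mul_eq_zero.1 ?_).resolve_right (pow_ne_zero k.val hb)
    rw [← hentry, Finset.sum_mul]
    exact Finset.sum_congr rfl fun j _ => by ring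
  exact fun ⟨j, k⟩ => congrFun (eq_zero_of_forall_sum_pow_val_mul_eq_zero hd (vandermonde k)) j

end MatrixModel

section Presentation

/-- `Q` is the algebra on the generators `x` and `y` with the defining relations of
`IsSymbolPair`. -/
structure IsSymbolAlgebra {F Q : Type u} [Field F] [Ring Q] [Algebra F Q] (p : ℕ)
    (ρ ε α β : F) (x y : Q) : Prop extends IsSymbolPair p ρ ε α β x y where
  adjoin_eq_top : Algebra.adjoin F {x, y} = ⊤
  exists_algHom {R : Type u} [Ring R] [Algebra F R] {x' y' : R} :
    IsSymbolPair p ρ ε α β x' y' → ∃ φ : Q →ₐ[F] R, φ x = x' ∧ φ y = y'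

variable {F : Type u} [Field F] {p : ℕ} {ρ ε α β : F}

theorem isSymbolAlgebra_ringQuot {r : FreeAlgebra F (Fin 2) → FreeAlgebra F (Fin 2) → Prop}
    (hr : ∀ {R : Type u} [Ring R] [Algebra F R] (f : FreeAlgebra F (Fin 2) →ₐ[F] R),
      (∀ ⦃u w⦄, r u w → f u = f w) ↔
        IsSymbolPair p ρ ε α β (f (FreeAlgebra.ι F 0)) (f (FreeAlgebra.ι F 1))) :
    IsSymbolAlgebra p ρ ε α β (RingQuot.mkAlgHom F r (FreeAlgebra.ι F 0))
      (RingQuot.mkAlgHom F r (FreeAlgebra.ι F 1)) where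
  toIsSymbolPair := (hr _).1 fun _ _ h => RingQuot.mkAlgHom_rel F h
  adjoin_eq_top := by
    rw [← Set.image_pair (RingQuot.mkAlgHom F r), ← AlgHom.map_adjoin]
    have range_ι : {FreeAlgebra.ι F (0 : Fin 2), FreeAlgebra.ι F 1} =
        Set.range (FreeAlgebra.ι F) := by
      ext z
      simp [eq_comm]
    rw [range_ι, FreeAlgebra.adjoin_range_ι, Algebra.map_top, AlgHom.range_eq_top]
    exact RingQuot.mkAlgHom_surjective F r
  exists_algHom {R _ _ x' y'} h := by
    have rel := (hr (FreeAlgebra.lift F ![x', y'])).2 (by simpa using h)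
    exact ⟨RingQuot.liftAlgHom F ⟨_, rel⟩, by simp, by simp⟩

theorem SymbolAlgebra.exists_isSymbolAlgebra (p : ℕ) (ρ α β : F) :
    ∃ x y : SymbolAlgebra p ρ α β, IsSymbolAlgebra p ρ 0 α β x y := by
  refine ⟨_, _, isSymbolAlgebra_ringQuot (r := SymbolRel p ρ α β) fun f => ⟨fun h => ?_, ?_⟩⟩
  · exact ⟨by simpa using h .x_pow, by simpa using h .y_pow,
      by simpa [Algebra.smul_def] using h .comm⟩
  · rintro ⟨hx, hy, hyx⟩ u w (_ | _ | _)
    · simpa using hx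
    · simpa using hy
    · simpa [Algebra.smul_def] using hyx

theorem CharPSymbolAlgebra.exists_isSymbolAlgebra (p : ℕ) (α β : F) :
    ∃ x y : CharPSymbolAlgebra p α β, IsSymbolAlgebra p 1 1 α β x y := by
  refine ⟨_, _, isSymbolAlgebra_ringQuot (r := CharPSymbolRel p α β) fun f => ⟨fun h => ?_, ?_⟩⟩
  · exact ⟨by simpa [sub_eq_iff_eq_add] using h .x_pow, by simpa using h .y_pow,
      by simpa using h .comm⟩
  · rintro ⟨hx, hy, hyx⟩ u w (_ | _ | _)
    · simpa [sub_eq_iff_eq_add] using hx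
    · simpa using hy
    · simpa using hyx

end Presentation

section Splitting

/-- A representation of `A` by matrices over an extension field `K` which splits `A` (a basis of `A`
spans the matrix algebra and has the right cardinality) and in which the basis members other than
`B g₀` have trace `0`, so that the trace form is `τ` times the coordinate at `g₀`. -/
structure IsSplitting {F K A κ n : Type*} [Field F] [Field K] [Algebra F K] [Ring A] [Algebra F A]
    [Fintype κ] [Fintype n] [DecidableEq n] (B : Basis κ F A) (φ : A →ₐ[F] Matrix n n K) (g₀ : κ)
    (τ : F) : Prop where
  card_index : Fintype.card κ = Fintype.card n * Fintype.card n
  span_eq_top : Submodule.span K (Set.range fun g => φ (B g)) = ⊤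
  trace_basis_self : (φ (B g₀)).trace = algebraMap F K τ
  trace_basis_of_ne {g : κ} : g ≠ g₀ → (φ (B g)).trace = 0

theorem trace_algEquiv_apply {K n m : Type*} [Field K] [Fintype n] [DecidableEq n]
    [Fintype m] [DecidableEq m] (f : Matrix n n K ≃ₐ[K] Matrix m m K) (M : Matrix n n K) :
    (f M).trace = M.trace := by
  obtain ⟨T, hT⟩ := AlgEquiv.eq_linearEquivConjAlgEquiv
    ((Matrix.toLinAlgEquiv' (R := K) (n := n)).symm.trans (f.trans Matrix.toLinAlgEquiv'))
  have conj : Matrix.toLin' (f M) = T.conj (Matrix.toLin' M) := by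
    have := DFunLike.congr_fun hT (Matrix.toLin' M)
    change Matrix.toLin' (f (LinearMap.toMatrix' (Matrix.toLin' M))) = _ at this
    rwa [LinearMap.toMatrix'_toLin'] at this
  rw [← Matrix.trace_toLin'_eq, conj, LinearMap.trace_conj', Matrix.trace_toLin'_eq]

theorem reducedTrace_eq {F A : Type u} [Field F] [Ring A] [Algebra F A]
    {n : Type*} [Fintype n] [DecidableEq n]
    (e : AlgebraicClosure F ⊗[F] A ≃ₐ[AlgebraicClosure F] Matrix n n (AlgebraicClosure F))
    {a : A} {t : F} (h : (e (1 ⊗ₜ[F] a)).trace = algebraMap F (AlgebraicClosure F) t) :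
    reducedTrace F a = t := by
  classical
  have hex : ∃ t : F, IsReducedTrace F a t := by
    refine ⟨t, Fintype.card n, e.trans (Matrix.reindexAlgEquiv _ _ (Fintype.equivFin n)), ?_⟩
    rw [← h, AlgEquiv.trans_apply, trace_algEquiv_apply]
  obtain ⟨d, e', he'⟩ := hex.choose_spec
  rw [reducedTrace, dif_pos hex]
  apply (algebraMap F (AlgebraicClosure F)).injective
  rw [← he', ← h, ← trace_algEquiv_apply (e'.symm.trans e) (e' (1 ⊗ₜ[F] a))]
  simp

namespace IsSplitting

theorem exists_algEquiv {F K A κ n : Type*} [Field F] [Field K] [Algebra F K] [Ring A]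
    [Algebra F A] [Fintype κ] [Fintype n] [DecidableEq n] {B : Basis κ F A}
    {φ : A →ₐ[F] Matrix n n K} {g₀ : κ} {τ : F} (h : IsSplitting B φ g₀ τ) :
    ∃ e : K ⊗[F] A ≃ₐ[K] Matrix n n K, ∀ a, e (1 ⊗ₜ a) = φ a := by
  let Φ : K ⊗[F] A →ₐ[K] Matrix n n K :=
    Algebra.TensorProduct.lift (Algebra.ofId K _) φ fun _ _ => Algebra.commutes _ _
  have hΦ (a : A) : Φ (1 ⊗ₜ a) = φ a :=
    (Algebra.TensorProduct.lift_tmul _ _ _ _ _).trans (by simp)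
  have surjective : Function.Surjective Φ.toLinearMap := by
    rw [← LinearMap.range_eq_top, eq_top_iff, ← h.span_eq_top, Submodule.span_le]
    rintro _ ⟨g, rfl⟩
    exact ⟨1 ⊗ₜ B g, hΦ _⟩
  have : Module.Finite F A := .of_basis B
  have injective : Function.Injective Φ.toLinearMap := by
    rw [LinearMap.injective_iff_surjective_of_finrank_eq_finrank]
    · exact surjective
    · rw [Module.finrank_baseChange, Module.finrank_eq_card_basis B, h.card_index,
        Module.finrank_matrix, Module.finrank_self, mul_one]
  exact ⟨.ofBijective Φ ⟨injective, surjective⟩, hΦ⟩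

theorem trace_apply {F K A κ n : Type*} [Field F] [Field K] [Algebra F K] [Ring A]
    [Algebra F A] [Fintype κ] [Fintype n] [DecidableEq n] {B : Basis κ F A}
    {φ : A →ₐ[F] Matrix n n K} {g₀ : κ} {τ : F} (h : IsSplitting B φ g₀ τ) (a : A) :
    (φ a).trace = algebraMap F K (τ * B.repr a g₀) := by
  conv_lhs => rw [← B.sum_repr a]
  simp only [map_sum, map_smul, Matrix.trace_sum, Matrix.trace_smul]
  rw [Finset.sum_eq_single g₀ (fun g _ hg => by rw [h.trace_basis_of_ne hg, smul_zero]) (by simp),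
    h.trace_basis_self, Algebra.smul_def, map_mul, mul_comm]

theorem reducedTrace_eq {F A : Type u} [Field F] [Ring A] [Algebra F A] {κ n : Type*} [Fintype κ]
    [Fintype n] [DecidableEq n] {B : Basis κ F A} {φ : A →ₐ[F] Matrix n n (AlgebraicClosure F)}
    {g₀ : κ} {τ : F} (h : IsSplitting B φ g₀ τ) (a : A) :
    reducedTrace F a = τ * B.repr a g₀ := by
  obtain ⟨e, he⟩ := h.exists_algEquiv
  exact _root_.reducedTrace_eq e (by rw [he, h.trace_apply])

end IsSplitting

end Splitting

section PowerSums

variable {K : Type*} [Field K] {p : ℕ}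

theorem pow_val_add_one_of_pow_eq_one {M : Type*} [Monoid M] {r : M} [NeZero p] (hr : r ^ p = 1)
    (t : ZMod p) : r ^ (t + 1).val = r ^ t.val * r := by
  obtain ht | ⟨ht, hp⟩ := zmod_val_add_one t
  · rw [ht, pow_succ]
  · rw [ht, ← pow_succ, hp, hr, ZMod.val_zero, pow_zero]

theorem sum_mul_primitiveRoot_pow_val_pow [NeZero p] {r : K} (hr : IsPrimitiveRoot r p) (a : K)
    (j : ZMod p) :
    ∑ t : ZMod p, (a * r ^ t.val) ^ j.val = if j = 0 then (p : K) else 0 := by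
  split_ifs with hj
  · simp [hj, ZMod.card]
  · have shift : ∑ t : ZMod p, (a * r ^ t.val) ^ j.val =
        r ^ j.val * ∑ t : ZMod p, (a * r ^ t.val) ^ j.val := by
      rw [Finset.mul_sum, ← Equiv.sum_comp (Equiv.addRight (1 : ZMod p))]
      refine Finset.sum_congr rfl fun t _ => ?_
      rw [Equiv.coe_addRight, pow_val_add_one_of_pow_eq_one hr.pow_eq_one, ← mul_assoc,
        mul_comm _ r, mul_pow]
    have r_pow_ne_one : r ^ j.val ≠ 1 :=
      hr.pow_ne_one_of_pos_of_lt ((ZMod.val_ne_zero j).2 hj) j.val_lt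
    exact (mul_left_eq_self₀.1 shift.symm).resolve_left r_pow_ne_one

theorem sum_castHom_pow [Fact p.Prime] [CharP K p] {n : ℕ} (hn : n < p) :
    ∑ t : ZMod p, (ZMod.castHom dvd_rfl K t) ^ n = if n = p - 1 then -1 else 0 := by
  simp only [← map_pow, ← map_sum]
  split_ifs with hn'
  · have fermat (t : ZMod p) : t ^ (p - 1) = 1 - if t = 0 then 1 else 0 := by
      split_ifs with ht
      · rw [ht, zero_pow (Nat.sub_pos_of_lt (Fact.out : p.Prime).one_lt).ne', sub_self]
      · rw [ZMod.pow_card_sub_one_eq_one ht, sub_zero]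
    simp [hn', fermat, ZMod.card]
  · rw [FiniteField.sum_pow_lt_card_sub_one (ZMod p) n (by rw [ZMod.card]; lia), map_zero]

theorem sum_add_castHom_pow [Fact p.Prime] [CharP K p] (a : K) {n : ℕ} (hn : n < p) :
    ∑ t : ZMod p, (a + ZMod.castHom dvd_rfl K t) ^ n = if n = p - 1 then -1 else 0 := by
  calc ∑ t : ZMod p, (a + ZMod.castHom dvd_rfl K t) ^ n
      = ∑ k ∈ Finset.range (n + 1),
          (∑ t : ZMod p, ZMod.castHom dvd_rfl K t ^ k) * (a ^ (n - k) * n.choose k) := by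
        simp only [add_comm a, add_pow, Finset.sum_mul, mul_assoc]
        exact Finset.sum_comm
    _ = (∑ t : ZMod p, ZMod.castHom dvd_rfl K t ^ n) * (a ^ (n - n) * n.choose n) := by
        refine Finset.sum_eq_single_of_mem n (Finset.self_mem_range_succ n) fun k hk hkn => ?_
        rw [Finset.mem_range] at hk
        rw [sum_castHom_pow (by lia), if_neg (by lia), zero_mul]
    _ = _ := by
        rw [sum_castHom_pow hn]
        simp

theorem exists_pow_eq_add_self [IsAlgClosed K] (hp : 1 < p) (c : K) : ∃ a : K, a ^ p = c + a := by
  have degree_ne_zero : (Polynomial.X ^ p - Polynomial.X - Polynomial.C c).degree ≠ 0 := by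
    rw [sub_sub, Polynomial.degree_sub_eq_left_of_degree_lt, Polynomial.degree_X_pow]
    · exact_mod_cast (one_pos.trans hp).ne'
    · rw [Polynomial.degree_X_add_C, Polynomial.degree_X_pow]
      exact_mod_cast hp
  obtain ⟨a, ha⟩ := IsAlgClosed.exists_root _ degree_ne_zero
  simp only [Polynomial.IsRoot, Polynomial.eval_sub, Polynomial.eval_pow, Polynomial.eval_X,
    Polynomial.eval_C] at ha
  exact ⟨a, by linear_combination ha⟩

end PowerSums

section SymbolSplitting

variable {F K Q : Type u} [Field F] [Field K] [Algebra F K] [IsAlgClosed K] [Ring Q] [Algebra F Q]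
  {p : ℕ} {ρ ε α β : F} {x y : Q}

theorem IsSymbolAlgebra.exists_isSplitting [NeZero p] (hp : 1 < p)
    (h : IsSymbolAlgebra p ρ ε α β x y) (hβ : β ≠ 0) {d : ZMod p → K} {j₀ : ZMod p} {τ : F}
    (hd_succ : ∀ t, d (t + 1) = ρ • d t + algebraMap F K ε)
    (hd : ∀ t, d t ^ p = algebraMap F K α + ε • d t) (hd_inj : Function.Injective d)
    (hd_sum : ∀ j, ∑ t, d t ^ j.val = if j = j₀ then algebraMap F K τ else 0) :
    ∃ (B : Basis (ZMod p × ZMod p) F Q) (φ : Q →ₐ[F] Matrix (ZMod p) (ZMod p) K),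
      (∀ g, B g = symbolMonomial x y g) ∧ IsSplitting B φ (j₀, 0) τ := by
  obtain ⟨b, hb⟩ := IsAlgClosed.exists_pow_nat_eq (algebraMap F K β) (NeZero.pos p)
  have hb₀ : b ≠ 0 := ne_zero_pow (NeZero.ne p) (hb ▸ (map_ne_zero _).2 hβ)
  obtain ⟨φ, hx, hy⟩ := h.exists_algHom (isSymbolPair_matrix hd_succ hd hb)
  have hφ (g : ZMod p × ZMod p) : φ (symbolMonomial x y g) =
      symbolMonomial (Matrix.diagonal d) (shiftMatrix p b) g := by
    simp only [symbolMonomial, map_mul, map_pow, hx, hy]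
  have independent_K := linearIndependent_symbolMonomial_matrix hd_inj hb₀
  have independent_F : LinearIndependent F (symbolMonomial (p := p) x y) := by
    refine .of_comp φ.toLinearMap ?_
    rw [show φ.toLinearMap ∘ symbolMonomial (p := p) x y = _ from funext hφ]
    exact independent_K.restrict_scalars' F
  let B := Basis.mk independent_F (h.span_symbolMonomial_eq_top hp h.adjoin_eq_top).ge
  have hB (g : ZMod p × ZMod p) : B g = symbolMonomial x y g := Basis.mk_apply _ _ g
  refine ⟨B, φ, hB, Fintype.card_prod _ _, ?_, ?_, fun {g} hg => ?_⟩
  · simp only [hB, hφ]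
    exact independent_K.span_eq_top_of_card_eq_finrank (by simp [Module.finrank_matrix])
  · simp [hB, hφ, trace_symbolMonomial, hd_sum]
  · rw [hB, hφ, trace_symbolMonomial]
    obtain ⟨j, k⟩ := g
    by_cases hk : k = 0
    · rw [if_pos hk, hd_sum, if_neg fun hj => hg (Prod.ext hj hk)]
    · rw [if_neg hk]

theorem IsSymbolAlgebra.exists_isSplitting_of_isPrimitiveRoot [NeZero p] (hp : 1 < p)
    (h : IsSymbolAlgebra p ρ 0 α β x y) (hρ : IsPrimitiveRoot ρ p) (hα : α ≠ 0) (hβ : β ≠ 0) :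
    ∃ (B : Basis (ZMod p × ZMod p) F Q) (φ : Q →ₐ[F] Matrix (ZMod p) (ZMod p) K),
      (∀ g, B g = symbolMonomial x y g) ∧ IsSplitting B φ 0 (p : F) := by
  have hr : IsPrimitiveRoot (algebraMap F K ρ) p := hρ.map_of_injective (algebraMap F K).injective
  obtain ⟨a, ha⟩ := IsAlgClosed.exists_pow_nat_eq (algebraMap F K α) (NeZero.pos p)
  have ha₀ : a ≠ 0 := ne_zero_pow (NeZero.ne p) (ha ▸ (map_ne_zero _).2 hα)
  refine h.exists_isSplitting hp hβ (d := fun t => a * algebraMap F K ρ ^ t.val)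
    (fun t => ?_) (fun t => ?_) (fun s t hst => ?_) (fun j => ?_)
  · rw [pow_val_add_one_of_pow_eq_one hr.pow_eq_one, Algebra.smul_def, map_zero, add_zero,
      ← mul_assoc, mul_comm]
  · rw [mul_pow, ← pow_mul, mul_comm, pow_mul', hr.pow_eq_one, one_pow, one_mul, ha, zero_smul,
      add_zero]
  · exact ZMod.val_injective p (hr.pow_inj s.val_lt t.val_lt (mul_left_cancel₀ ha₀ hst))
  · simp only [sum_mul_primitiveRoot_pow_val_pow hr, map_natCast]

theorem IsSymbolAlgebra.exists_isSplitting_of_charP [Fact p.Prime] [CharP F p]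
    (h : IsSymbolAlgebra p 1 1 α β x y) (hβ : β ≠ 0) :
    ∃ (B : Basis (ZMod p × ZMod p) F Q) (φ : Q →ₐ[F] Matrix (ZMod p) (ZMod p) K),
      (∀ g, B g = symbolMonomial x y g) ∧ IsSplitting B φ (((p - 1 : ℕ) : ZMod p), 0) (-1) := by
  have : CharP K p := charP_of_injective_algebraMap (algebraMap F K).injective p
  have hp : 1 < p := (Fact.out : p.Prime).one_lt
  obtain ⟨a, ha⟩ := exists_pow_eq_add_self hp (algebraMap F K α)
  refine h.exists_isSplitting hp hβ (d := fun t => a + ZMod.castHom dvd_rfl K t)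
    (fun t => ?_) (fun t => ?_) (fun s t hst => ?_) (fun j => ?_)
  · simp only [map_add, map_one, one_smul, add_assoc]
  · rw [add_pow_char, ← map_pow, ZMod.pow_card, ha, one_smul, add_assoc]
  · exact (ZMod.castHom dvd_rfl K).injective (add_left_cancel hst)
  · have val_eq_iff : j.val = p - 1 ↔ j = ((p - 1 : ℕ) : ZMod p) := by
      rw [← ZMod.val_cast_of_lt (Nat.sub_one_lt_of_lt hp), (ZMod.val_injective p).eq_iff]
      simp
    simp only [sum_add_castHom_pow a j.val_lt, val_eq_iff, map_neg, map_one]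

end SymbolSplitting

section SymbolNorm

variable {F Q Γ : Type*} [Field F] [Ring Q] [Algebra F Q] [AddCommGroup Γ] [LinearOrder Γ]
  [IsOrderedAddMonoid Γ] {v : AddValuation F (WithTop Γ)} {p : ℕ} {ρ ε α β : F} {x y : Q}
  {B : Basis (ZMod p × ZMod p) F Q} {a b : Γ}

/-- The value of the monomial `x ^ j * y ^ k` when `x` and `y` have the values `a` and `b`. -/
def monomialValue {p : ℕ} (a b : Γ) (g : ZMod p × ZMod p) : Γ :=
  g.1.val • a + g.2.val • b

/-- A valued symbol algebra with basis the monomials in `x` and `y`, such that `p • a = v α` and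
`p • b = v β` are the values forced on `x ^ p` and `y ^ p`. -/
structure IsValuedSymbol (v : AddValuation F (WithTop Γ)) (ρ ε α β : F) (x y : Q)
    (B : Basis (ZMod p × ZMod p) F Q) (a b : Γ) : Prop extends IsSymbolPair p ρ ε α β x y where
  basis_eq (g : ZMod p × ZMod p) : B g = symbolMonomial x y g
  value_left : v α = (p • a : Γ)
  value_right : v β = (p • b : Γ)
  left_neg : a < 0
  root_nonneg : 0 ≤ v ρ
  shift_nonneg : 0 ≤ v ε

theorem le_splitNorm_pow_mul {ι : Type*} [Fintype ι] {B : Basis ι F Q} {ω : ι → Γ} {z : Q}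
    (hz : ∀ c, a + splitNorm v B ω c ≤ splitNorm v B ω (z * c)) (n : ℕ) (c : Q) :
    (n • a : Γ) + splitNorm v B ω c ≤ splitNorm v B ω (z ^ n * c) := by
  induction n generalizing c with
  | zero => simp
  | succ n ih =>
    rw [pow_succ, mul_assoc, succ_nsmul, WithTop.coe_add, add_assoc]
    exact (add_le_add_right (hz c) _).trans (ih _)

theorem le_add_of_nsmul_add_le {δ δ' : WithTop Γ} (hp : 1 < p)
    (h : ((p - 1) • a : Γ) + δ ≤ (p • a : Γ) + δ') : δ ≤ a + δ' := by
  rw [← Nat.sub_add_cancel hp.le, Nat.add_sub_cancel, succ_nsmul, WithTop.coe_add, add_assoc] at h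
  exact (WithTop.add_le_add_iff_left WithTop.coe_ne_top).1 h

namespace IsValuedSymbol

variable [NeZero p]

theorem le_splitNorm_shift_mul (h : IsValuedSymbol v ρ ε α β x y B a b)
    (hx : ∀ c, a + splitNorm v B (monomialValue a b) c ≤ splitNorm v B (monomialValue a b) (x * c))
    (j : ℕ) (c : Q) :
    (j • a : Γ) + splitNorm v B (monomialValue a b) c ≤
      splitNorm v B (monomialValue a b) ((ρ • x + ε • 1) ^ j * c) := by
  refine le_splitNorm_pow_mul (fun c => ?_) j c
  rw [add_mul, smul_one_mul, smul_mul_assoc]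
  refine le_splitNorm_add ?_ ?_ <;> rw [splitNorm_smul]
  · exact (hx c).trans (le_add_of_nonneg_left h.root_nonneg)
  · exact add_le_add_left ((WithTop.coe_le_coe.2 h.left_neg.le).trans h.shift_nonneg) _

theorem le_splitNorm_x_mul (h : IsValuedSymbol v ρ ε α β x y B a b) (hp : 1 < p) (c : Q) :
    a + splitNorm v B (monomialValue a b) c ≤ splitNorm v B (monomialValue a b) (x * c) := by
  refine add_le_splitNorm_map (f := LinearMap.mulLeft F x) (fun ⟨j, k⟩ => ?_) c
  rw [LinearMap.mulLeft_apply, h.basis_eq, ← WithTop.coe_add]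
  obtain ⟨hj, hx⟩ | ⟨hj, hx⟩ := h.x_mul_symbolMonomial hp j k
  · rw [hx, ← h.basis_eq, splitNorm_basis]
    simp only [monomialValue, hj, succ_nsmul', add_assoc, le_refl]
  · have value : a + monomialValue a b (j, k) = p • a + k.val • b := by
      rw [monomialValue, ← add_assoc, ← succ_nsmul', hj]
    rw [hx, ← h.basis_eq, ← h.basis_eq, value]
    refine le_splitNorm_add ?_ ?_ <;> rw [splitNorm_smul, splitNorm_basis, monomialValue]
    · rw [h.value_left, ← WithTop.coe_add, ZMod.val_zero, zero_nsmul, zero_add]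
    · refine le_add_of_nonneg_of_le h.shift_nonneg (WithTop.coe_le_coe.2 (add_le_add_left ?_ _))
      exact nsmul_le_nsmul_left_of_nonpos h.left_neg.le ((ZMod.val_one'' hp.ne').trans_le hp.le)

theorem le_splitNorm_y_mul (h : IsValuedSymbol v ρ ε α β x y B a b) (hp : 1 < p) (c : Q) :
    b + splitNorm v B (monomialValue a b) c ≤ splitNorm v B (monomialValue a b) (y * c) := by
  refine add_le_splitNorm_map (f := LinearMap.mulLeft F y) (fun ⟨j, k⟩ => ?_) c
  have hxj := h.le_splitNorm_shift_mul (h.le_splitNorm_x_mul hp) j.val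
  rw [LinearMap.mulLeft_apply, h.basis_eq, ← WithTop.coe_add]
  obtain ⟨hk, hy⟩ | ⟨hk, hy⟩ := h.y_mul_symbolMonomial j k <;>
    rw [hy, ← h.basis_eq] <;> refine (le_of_eq ?_).trans (hxj _)
  · rw [splitNorm_basis, ← WithTop.coe_add]
    simp only [monomialValue, hk, ZMod.val_zero, zero_nsmul, zero_add, succ_nsmul', add_left_comm]
  · have value : b + monomialValue a b (j, k) = j.val • a + p • b := by
      rw [monomialValue, add_left_comm, ← succ_nsmul', hk]
    rw [value, splitNorm_smul, splitNorm_basis, h.value_right]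
    simp [monomialValue]

theorem splitNorm_x_mul (h : IsValuedSymbol v ρ ε α β x y B a b) (hp : 1 < p) (c : Q) :
    splitNorm v B (monomialValue a b) (x * c) = a + splitNorm v B (monomialValue a b) c := by
  refine (h.le_splitNorm_x_mul hp c).antisymm' ?_
  have x_pow_mul : α • c = x ^ (p - 1) * (x * c) + -(ε • (x * c)) := by
    rw [← mul_assoc, ← pow_succ, Nat.sub_add_cancel hp.le, h.x_pow, add_mul, smul_mul_assoc,
      ← Algebra.smul_def, add_neg_cancel_right]
  have shift_nonneg : ((p - 1) • a : Γ) ≤ v ε :=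
    (WithTop.coe_le_coe.2 (nsmul_nonpos h.left_neg.le _)).trans h.shift_nonneg
  have le_smul : ((p - 1) • a : Γ) + splitNorm v B (monomialValue a b) (x * c) ≤
      splitNorm v B (monomialValue a b) (α • c) := by
    rw [x_pow_mul]
    refine le_splitNorm_add (le_splitNorm_pow_mul (h.le_splitNorm_x_mul hp) _ _) ?_
    rw [splitNorm_neg, splitNorm_smul]
    exact add_le_add_left shift_nonneg _
  exact le_add_of_nsmul_add_le hp (le_smul.trans_eq (by rw [splitNorm_smul, h.value_left]))

theorem splitNorm_y_mul (h : IsValuedSymbol v ρ ε α β x y B a b) (hp : 1 < p) (c : Q) :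
    splitNorm v B (monomialValue a b) (y * c) = b + splitNorm v B (monomialValue a b) c := by
  refine (h.le_splitNorm_y_mul hp c).antisymm' ?_
  have y_pow_mul : y ^ (p - 1) * (y * c) = β • c := by
    rw [← mul_assoc, ← pow_succ, Nat.sub_add_cancel hp.le, h.y_pow, ← Algebra.smul_def]
  have le_smul := le_splitNorm_pow_mul (h.le_splitNorm_y_mul hp) (p - 1) (y * c)
  exact le_add_of_nsmul_add_le hp
    (le_smul.trans_eq (by rw [y_pow_mul, splitNorm_smul, h.value_right]))

theorem splitNorm_basis_mul (h : IsValuedSymbol v ρ ε α β x y B a b) (hp : 1 < p)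
    (g : ZMod p × ZMod p) (c : Q) :
    splitNorm v B (monomialValue a b) (B g * c) =
      monomialValue a b g + splitNorm v B (monomialValue a b) c := by
  have pow_mul {z : Q} {γ : Γ} (hz : ∀ c, splitNorm v B (monomialValue a b) (z * c) =
      γ + splitNorm v B (monomialValue a b) c) (n : ℕ) (c : Q) :
      splitNorm v B (monomialValue a b) (z ^ n * c) =
        (n • γ : Γ) + splitNorm v B (monomialValue a b) c := by
    induction n with
    | zero => simp
    | succ n ih => rw [pow_succ', mul_assoc, hz, ih, succ_nsmul', WithTop.coe_add, add_assoc]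
  rw [h.basis_eq, symbolMonomial, mul_assoc, pow_mul (h.splitNorm_x_mul hp),
    pow_mul (h.splitNorm_y_mul hp), ← add_assoc, monomialValue, WithTop.coe_add]

variable {π : Γ →+ ZMod p × ZMod p}

theorem isArmature (h : IsValuedSymbol v ρ ε α β x y B a b) (hp : 1 < p)
    (hv : ∀ {c : F} {γ : Γ}, v c = γ → π γ = 0) (ha : π a = (1, 0)) (hb : π b = (0, 1)) :
    IsArmature v B (monomialValue a b) π where
  splitNorm_one := by
    have one_eq : (1 : Q) = B 0 := by simp [h.basis_eq, symbolMonomial]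
    simp [one_eq, splitNorm_basis, monomialValue]
  splitNorm_mul_basis g h' := by rw [h.splitNorm_basis_mul hp, splitNorm_basis]
  class_scalar := hv
  class_index g := by simp [monomialValue, ha, hb]

theorem leadingCommute_basis (h : IsValuedSymbol v 1 ε α β x y B a b) (hp : 1 < p)
    (H : IsArmature v B (monomialValue a b) π) (g g' : ZMod p × ZMod p) :
    LeadingCommute H.valuation (B g) (B g') := by
  have value_x : H.valuation x = a := by
    have hx : x = B (1, 0) := by simp [h.basis_eq, symbolMonomial, ZMod.val_one'' hp.ne']
    simp [hx, H.valuation_basis, monomialValue, ZMod.val_one'' hp.ne']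
  have value_y : H.valuation y = b := by
    have hy : y = B (0, 1) := by simp [h.basis_eq, symbolMonomial, ZMod.val_one'' hp.ne']
    simp [hy, H.valuation_basis, monomialValue, ZMod.val_one'' hp.ne']
  have commutator : y * x - x * y = ε • y := by
    rw [h.y_mul_x, one_smul, add_mul, add_sub_cancel_left, smul_one_mul]
  have comm_yx : LeadingCommute H.valuation y x := by
    rw [LeadingCommute, commutator, H.valuation_smul, value_x, value_y, add_comm]
    refine (add_lt_add_iff_left_of_ne_top WithTop.coe_ne_top).2 ?_
    exact (WithTop.coe_lt_coe.2 h.left_neg).trans_le h.shift_nonneg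
  have comm_self (z : Q) {γ : Γ} (hz : H.valuation z = γ) : LeadingCommute H.valuation z z :=
    .of_commute (.refl z) (by simp [hz]) (by simp [hz])
  have comm_monomial {z : Q} (hx : LeadingCommute H.valuation z x)
      (hy : LeadingCommute H.valuation z y) : LeadingCommute H.valuation z (B g') := by
    rw [h.basis_eq]
    exact (hx.pow_right _).mul_right (hy.pow_right _)
  rw [h.basis_eq g]
  exact ((comm_monomial (comm_self x value_x) comm_yx.symm).pow_left _).mul_left
    ((comm_monomial comm_yx (comm_self y value_y)).pow_left _)

end IsValuedSymbol

end SymbolNorm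

section Kronecker

variable {ι n K : Type*} [Fintype ι] [CommRing K]

/-- The Kronecker product of a family of square matrices, as a multilinear map. -/
def piKronecker (ι n K : Type*) [Fintype ι] [CommRing K] :
    MultilinearMap K (fun _ : ι => Matrix n n K) (Matrix (ι → n) (ι → n) K) :=
  (Matrix.ofLinearEquiv K).toLinearMap.compMultilinearMap <| .pi fun k => .pi fun l =>
    (MultilinearMap.mkPiAlgebra K ι K).compLinearMap fun i => Matrix.entryLinearMap K K (k i) (l i)

theorem piKronecker_apply (M : ι → Matrix n n K) (k l : ι → n) :
    piKronecker ι n K M k l = ∏ i, M i (k i) (l i) :=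
  rfl

theorem piKronecker_single [DecidableEq n] (k l : ι → n) :
    piKronecker ι n K (fun i => Matrix.single (k i) (l i) 1) = Matrix.single k l 1 := by
  ext k' l'
  simp [piKronecker_apply, Matrix.single_apply, Fintype.prod_ite_zero, funext_iff, forall_and]

theorem piKronecker_one [DecidableEq n] : piKronecker ι n K (fun _ => 1) = 1 := by
  ext k l
  simp [piKronecker_apply, Matrix.one_apply, Fintype.prod_ite_zero, funext_iff]

theorem span_piKronecker_eq_top [Finite n] {κ : Type*} [Finite κ]
    {b : ι → κ → Matrix n n K} (hb : ∀ i, Submodule.span K (Set.range (b i)) = ⊤) :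
    Submodule.span K (Set.range fun g : ι → κ => piKronecker ι n K fun i => b i (g i)) = ⊤ := by
  classical
  have := Fintype.ofFinite κ
  have := Fintype.ofFinite n
  refine Submodule.eq_top_iff'.2 fun M => ?_
  have kronecker_mem (N : ι → Matrix n n K) : piKronecker ι n K N ∈
      Submodule.span K (Set.range fun g : ι → κ => piKronecker ι n K fun i => b i (g i)) := by
    have hN (i : ι) : ∃ c : κ → K, ∑ g, c g • b i g = N i :=
      Submodule.mem_span_range_iff_exists_fun K |>.1 (hb i ▸ Submodule.mem_top)
    choose c hc using hN
    rw [← funext hc, MultilinearMap.map_sum]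
    refine Submodule.sum_mem _ fun g _ => ?_
    rw [MultilinearMap.map_smul_univ]
    exact Submodule.smul_mem _ _ (Submodule.subset_span ⟨g, rfl⟩)
  rw [Matrix.matrix_eq_sum_single M]
  refine Submodule.sum_mem _ fun k _ => Submodule.sum_mem _ fun l _ => ?_
  rw [← mul_one (M k l), ← smul_eq_mul, ← Matrix.smul_single, ← piKronecker_single]
  exact Submodule.smul_mem _ _ (kronecker_mem _)

variable [Fintype n] [DecidableEq ι]

theorem piKronecker_mul (M N : ι → Matrix n n K) :
    piKronecker ι n K (fun i => M i * N i) = piKronecker ι n K M * piKronecker ι n K N := by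
  ext k l
  simp only [piKronecker_apply, Matrix.mul_apply, Finset.prod_univ_sum,
    Finset.prod_mul_distrib, Fintype.piFinset_univ]

theorem trace_piKronecker (M : ι → Matrix n n K) :
    (piKronecker ι n K M).trace = ∏ i, (M i).trace := by
  simp only [piKronecker_apply, Matrix.trace, Matrix.diag, Finset.prod_univ_sum,
    Fintype.piFinset_univ]

end Kronecker

section TensorSplitting

variable {ι F K n κ : Type*} {Q : ι → Type*} [Fintype ι] [DecidableEq ι] [Field F] [Field K]
  [Algebra F K] [∀ i, Ring (Q i)] [∀ i, Algebra F (Q i)] [Fintype n] [DecidableEq n]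

/-- The tensor product of matrix representations. -/
def piTensorRep (φ : ∀ i, Q i →ₐ[F] Matrix n n K) :
    (⨂[F] i, Q i) →ₐ[F] Matrix (ι → n) (ι → n) K :=
  PiTensorProduct.liftAlgHom
    (((piKronecker ι n K).restrictScalars F).compLinearMap fun i => (φ i).toLinearMap)
    (by simpa using piKronecker_one)
    (fun x y => by simpa using piKronecker_mul (fun i => φ i (x i)) fun i => φ i (y i))

variable {φ : ∀ i, Q i →ₐ[F] Matrix n n K}

theorem piTensorRep_tprod (a : ∀ i, Q i) :
    piTensorRep φ (PiTensorProduct.tprod F a) = piKronecker ι n K fun i => φ i (a i) := by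
  simp [piTensorRep]

theorem IsSplitting.piTensorProduct [Fintype κ] {B : ∀ i, Basis κ F (Q i)} {g₀ : ι → κ}
    {τ : ι → F} (h : ∀ i, IsSplitting (B i) (φ i) (g₀ i) (τ i)) :
    IsSplitting (Basis.piTensorProduct B) (piTensorRep φ) g₀ (∏ i, τ i) where
  card_index := by
    obtain _ | ⟨⟨i⟩⟩ := isEmpty_or_nonempty ι
    · simp
    · simp only [Fintype.card_fun, (h i).card_index, mul_pow]
  span_eq_top := by
    simp only [Basis.piTensorProduct_apply, piTensorRep_tprod]
    exact span_piKronecker_eq_top (b := fun i g => φ i (B i g)) fun i => (h i).span_eq_top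
  trace_basis_self := by
    simp only [Basis.piTensorProduct_apply, piTensorRep_tprod, trace_piKronecker,
      (h _).trace_basis_self, map_prod]
  trace_basis_of_ne {g} hg := by
    obtain ⟨i, hi⟩ := Function.ne_iff.1 hg
    rw [Basis.piTensorProduct_apply, piTensorRep_tprod, trace_piKronecker]
    exact Finset.prod_eq_zero (Finset.mem_univ i) ((h i).trace_basis_of_ne hi)

end TensorSplitting

theorem addValuation_prod {R M ι : Type*} [CommRing R] [LinearOrderedAddCommMonoidWithTop M]
    (v : AddValuation R M) (s : Finset ι) (f : ι → R) :
    v (∏ i ∈ s, f i) = ∑ i ∈ s, v (f i) := by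
  induction s using Finset.cons_induction with
  | empty => simp
  | cons i s hi ih => rw [Finset.prod_cons, v.map_mul, ih, Finset.sum_cons]

section TensorNorm

variable {ι F : Type*} {Q : ι → Type*} [Field F] [∀ i, Ring (Q i)] [∀ i, Algebra F (Q i)]

theorem leadingCommute_tprod_left [Finite ι] [DecidableEq ι] {M : Type*}
    [LinearOrderedAddCommMonoidWithTop M] {w : AddValuation (⨂[F] i, Q i) M} {a : ∀ i, Q i}
    {d : ⨂[F] i, Q i} (hd : w d ≠ ⊤)
    (h : ∀ i, LeadingCommute w (PiTensorProduct.singleAlgHom i (a i)) d) :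
    LeadingCommute w (PiTensorProduct.tprod F a) d := by
  have one_ne_top : w 1 ≠ ⊤ := fun h1 => hd (by rw [← one_mul d, w.map_mul, h1, top_add])
  let S : Submonoid (⨂[F] i, Q i) :=
    { carrier := {z | LeadingCommute w z d}
      mul_mem' := .mul_left
      one_mem' := .of_commute (.one_left d) one_ne_top hd }
  exact Submonoid.pi_mem_of_mulSingle_mem (H := S.comap (PiTensorProduct.tprodMonoidHom F)) a h

variable {Γ κ : Type*} [Fintype ι] [DecidableEq ι] [AddCommGroup Γ] [LinearOrder Γ]
  [IsOrderedAddMonoid Γ] {v : AddValuation F (WithTop Γ)}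

theorem splitNorm_tprod [Fintype κ] [Nonempty κ] {B : ∀ i, Basis κ F (Q i)}
    {ω : ι → κ → Γ} (a : ∀ i, Q i) :
    splitNorm v (Basis.piTensorProduct B) (fun g => ∑ i, ω i (g i)) (PiTensorProduct.tprod F a) =
      ∑ i, splitNorm v (B i) (ω i) (a i) := by
  have term (g : ι → κ) : v ((Basis.piTensorProduct B).repr (PiTensorProduct.tprod F a) g) +
      (∑ i, ω i (g i) : Γ) = ∑ i, (v ((B i).repr (a i) (g i)) + ω i (g i)) := by
    rw [Basis.piTensorProduct_repr_tprod_apply, addValuation_prod, Finset.sum_add_distrib,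
      WithTop.coe_sum]
  apply le_antisymm
  · choose g hg using fun i => exists_splitNorm_eq (v := v) (B := B i) (ω := ω i) (a i)
    rw [Finset.sum_congr rfl fun i _ => hg i, ← term]
    exact splitNorm_le _ g
  · refine le_splitNorm_iff.2 fun g => ?_
    rw [term]
    exact Finset.sum_le_sum fun i _ => splitNorm_le _ _

variable {G : Type*} [AddCommGroup G] [Fintype G] {B : ∀ i, Basis G F (Q i)} {ω : ι → G → Γ}
  {π : Γ →+ (ι → G)}

theorem IsArmature.piTensorProduct
    (H : ∀ i, IsArmature v (B i) (ω i) ((Pi.evalAddMonoidHom _ i).comp π))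
    (hπ : ∀ i j g, j ≠ i → π (ω i g) j = 0) :
    IsArmature v (Basis.piTensorProduct B) (fun g => ∑ i, ω i (g i)) π where
  splitNorm_one := by
    rw [PiTensorProduct.one_def, splitNorm_tprod]
    exact Finset.sum_eq_zero fun i _ => (H i).splitNorm_one
  splitNorm_mul_basis g h := by
    rw [Basis.piTensorProduct_apply, Basis.piTensorProduct_apply, PiTensorProduct.tprod_mul_tprod,
      splitNorm_tprod, WithTop.coe_sum, WithTop.coe_sum, ← Finset.sum_add_distrib]
    exact Finset.sum_congr rfl fun i _ => (H i).splitNorm_mul_basis (g i) (h i)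
  class_scalar hc := funext fun i => (H i).class_scalar hc
  class_index g := by
    funext i
    rw [map_sum, Finset.sum_apply, Finset.sum_eq_single i (fun j _ hj => hπ j i _ hj.symm)
      (by simp)]
    exact (H i).class_index (g i)

theorem IsArmature.leadingCommute_basis_piTensorProduct
    (H : ∀ i, IsArmature v (B i) (ω i) ((Pi.evalAddMonoidHom _ i).comp π))
    (hB : ∀ i g h, LeadingCommute (H i).valuation (B i g) (B i h))
    (HT : IsArmature v (Basis.piTensorProduct B) (fun g => ∑ i, ω i (g i)) π) (g h : ι → G) :
    LeadingCommute HT.valuation (Basis.piTensorProduct B g) (Basis.piTensorProduct B h) := by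
  have valuation_single (i : ι) (a : Q i) :
      HT.valuation (PiTensorProduct.singleAlgHom i a) = (H i).valuation a := by
    refine (splitNorm_tprod _).trans ?_
    rw [Finset.sum_eq_single i (fun j _ hj => ?_) (by simp)]
    · simp [IsArmature.valuation]
    · simpa [Pi.mulSingle_eq_of_ne hj] using (H j).splitNorm_one
  have basis_ne_top (g : ι → G) : HT.valuation (Basis.piTensorProduct B g) ≠ ⊤ := by
    rw [HT.valuation_basis]
    exact WithTop.coe_ne_top
  have single_ne_top (i : ι) (g : G) :
      HT.valuation (PiTensorProduct.singleAlgHom i (B i g)) ≠ ⊤ := by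
    rw [valuation_single, (H i).valuation_basis]
    exact WithTop.coe_ne_top
  have comm_single (i j : ι) :
      LeadingCommute HT.valuation (PiTensorProduct.singleAlgHom i (B i (g i)))
        (PiTensorProduct.singleAlgHom j (B j (h j))) := by
    obtain rfl | hij := eq_or_ne i j
    · have hi := hB i (g i) (h i)
      rwa [LeadingCommute, ← valuation_single, ← valuation_single, ← valuation_single, map_sub,
        map_mul, map_mul] at hi
    · refine .of_commute ?_ (single_ne_top i _) (single_ne_top j _)
      exact (Pi.mulSingle_commute hij (B i (g i)) (B j (h j))).map
        (PiTensorProduct.tprodMonoidHom F)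
  simp only [Basis.piTensorProduct_apply] at basis_ne_top ⊢
  refine leadingCommute_tprod_left (basis_ne_top h) fun i => .symm ?_
  exact leadingCommute_tprod_left (single_ne_top i _) fun j => (comm_single i j).symm

end TensorNorm

section LaurentValuation

variable {K Γ : Type*} [Field K] [AddCommGroup Γ] [LinearOrder Γ] [IsOrderedAddMonoid Γ]
  (v : AddValuation K (WithTop Γ))

/-- The value of a Laurent series for the extension of `v` that ranks the order of the series before
the value of its leading coefficient. -/
def laurentValue (f : LaurentSeries K) : WithTop (ℤ ×ₗ Γ) :=
  (v f.leadingCoeff).map fun γ => toLex (f.order, γ)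

theorem laurentValue_zero : laurentValue v 0 = ⊤ := by
  simp [laurentValue]

theorem laurentValue_single (n : ℤ) {a : K} (ha : a ≠ 0) :
    laurentValue v (HahnSeries.single n a) = (v a).map fun γ => toLex (n, γ) := by
  simp [laurentValue, HahnSeries.order_single ha]

theorem laurentValue_C (a : K) :
    laurentValue v (HahnSeries.C a) = (v a).map fun γ => toLex (0, γ) := by
  rw [laurentValue, HahnSeries.order_C, HahnSeries.C_apply, HahnSeries.leadingCoeff_of_single]

theorem le_laurentValue_iff {f : LaurentSeries K} {n : ℤ} {γ : Γ} :
    (toLex (n, γ) : ℤ ×ₗ Γ) ≤ laurentValue v f ↔ n ≤ f.orderTop ∧ γ ≤ v (f.coeff n) := by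
  obtain rfl | hf := eq_or_ne f 0
  · simp [laurentValue_zero]
  obtain ⟨δ, hδ⟩ := WithTop.ne_top_iff_exists.1
    (v.ne_top_iff.2 (HahnSeries.leadingCoeff_ne_zero.2 hf))
  rw [laurentValue, ← hδ, ← HahnSeries.order_eq_orderTop_of_ne_zero hf, WithTop.map_coe,
    WithTop.coe_le_coe, WithTop.coe_le_coe, Prod.Lex.toLex_le_toLex]
  rw [HahnSeries.leadingCoeff_eq] at hδ
  obtain hlt | rfl | hgt := lt_trichotomy n f.order
  · simp [hlt, hlt.le, HahnSeries.coeff_eq_zero_of_lt_order hlt]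
  · simp [← hδ]
  · simp [hgt.not_gt, hgt.not_ge, hgt.ne']

theorem laurentValue_add (f g : LaurentSeries K) :
    min (laurentValue v f) (laurentValue v g) ≤ laurentValue v (f + g) := by
  obtain rfl | hf := eq_or_ne f 0
  · simp
  have min_ne_top : min (laurentValue v f) (laurentValue v g) ≠ ⊤ := by
    refine ne_top_of_le_ne_top ?_ (min_le_left _ _)
    simpa [laurentValue] using hf
  obtain ⟨⟨n, γ⟩, hmin⟩ := WithTop.ne_top_iff_exists.1 min_ne_top
  obtain ⟨hfn, hfγ⟩ := (le_laurentValue_iff v).1 (hmin.trans_le (min_le_left _ _))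
  obtain ⟨hgn, hgγ⟩ := (le_laurentValue_iff v).1 (hmin.trans_le (min_le_right _ _))
  rw [← hmin]
  exact (le_laurentValue_iff v).2
    ⟨(le_min hfn hgn).trans HahnSeries.min_orderTop_le_orderTop_add, v.map_le_add hfγ hgγ⟩

theorem laurentValue_mul (f g : LaurentSeries K) :
    laurentValue v (f * g) = laurentValue v f + laurentValue v g := by
  obtain rfl | hf := eq_or_ne f 0
  · simp [laurentValue_zero]
  obtain rfl | hg := eq_or_ne g 0
  · simp [laurentValue_zero]
  have value_add (n k : ℤ) (γ δ : WithTop Γ) : (γ + δ).map (fun ε => toLex (n + k, ε)) =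
      γ.map (fun ε => toLex (n, ε)) + δ.map fun ε => toLex (k, ε) := by
    cases γ <;> cases δ <;> rfl
  rw [laurentValue, HahnSeries.leadingCoeff_mul, HahnSeries.order_mul hf hg, v.map_mul, value_add,
    laurentValue, laurentValue]

/-- The extension of a valuation to Laurent series, by the order and the value of the leading
coefficient. -/
def laurentValuation : AddValuation (LaurentSeries K) (WithTop (ℤ ×ₗ Γ)) :=
  .of (laurentValue v) (laurentValue_zero v)
    (by rw [← map_one HahnSeries.C, laurentValue_C, v.map_one]; rfl)
    (laurentValue_add v) (laurentValue_mul v)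

end LaurentValuation

/-- A valuation on `F`, trivial on the constants `c a`, for which the `t s` have negative values
that are independent; the independence is witnessed by coordinates `coord` on the value group. -/
structure IndependentValuation {F₀ F σ : Type*} [Field F₀] [Field F] [DecidableEq σ]
    (c : F₀ →+* F) (t : σ → F) where
  /-- The value group. -/
  Γ : Type
  [addCommGroup : AddCommGroup Γ]
  [linearOrder : LinearOrder Γ]
  [isOrderedAddMonoid : IsOrderedAddMonoid Γ]
  /-- The valuation. -/
  v : AddValuation F (WithTop Γ)
  /-- The values of the `t s`. -/
  value : σ → Γ
  /-- The coordinates on the value group. -/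
  coord : Γ →+ (σ → ℤ)
  map_const {a : F₀} (ha : a ≠ 0) : v (c a) = 0
  map_var (s : σ) : v (t s) = value s
  value_neg (s : σ) : value s < 0
  coord_value (s : σ) : coord (value s) = Pi.single s 1

namespace IndependentValuation

attribute [instance] addCommGroup linearOrder isOrderedAddMonoid

variable {F₀ E F σ σ' : Type*} [Field F₀] [Field E] [Field F] [DecidableEq σ] [DecidableEq σ']
  {c : F₀ →+* F} {t : σ → F}

open Classical in
/-- The trivial valuation, with no variables. -/
def ofTrivial (F₀ : Type*) [Field F₀] :
    IndependentValuation (RingHom.id F₀) (Empty.elim : Empty → F₀) where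
  Γ := ℤ
  v := .of (fun a => if a = 0 then ⊤ else 0) (by simp) (by simp)
    (fun a b => by split_ifs <;> simp_all)
    (fun a b => by by_cases a = 0 <;> by_cases b = 0 <;> simp [*])
  value := Empty.elim
  coord := 0
  map_const ha := if_neg ha
  map_var := Empty.rec
  value_neg := Empty.rec
  coord_value := Empty.rec

/-- The restriction to a subfield and to some of the variables. -/
def comap (W : IndependentValuation c t) (f : E →+* F) {j : σ' → σ} (hj : j.Injective)
    {c' : F₀ →+* E} {t' : σ' → E} (hc : ∀ a, f (c' a) = c a) (ht : ∀ s, f (t' s) = t (j s)) :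
    IndependentValuation c' t' where
  Γ := W.Γ
  v := W.v.comap f
  value := W.value ∘ j
  coord := (LinearMap.funLeft ℤ ℤ j).toAddMonoidHom.comp W.coord
  map_const {a} ha := (congrArg W.v (hc a)).trans (W.map_const ha)
  map_var s := (congrArg W.v (ht s)).trans (W.map_var (j s))
  value_neg s := W.value_neg (j s)
  coord_value s := by
    ext s'
    simp [LinearMap.funLeft_apply, W.coord_value, Pi.single_apply, hj.eq_iff]

/-- The extension to Laurent series, the inverse of the series variable being the new variable. -/
def laurent (W : IndependentValuation c t) :
    IndependentValuation ((HahnSeries.C : F →+* LaurentSeries F).comp c)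
      (fun o : Option σ => o.elim (HahnSeries.single (-1) 1) fun s => HahnSeries.C (t s)) where
  Γ := ℤ ×ₗ W.Γ
  v := laurentValuation W.v
  value o := o.elim (toLex (-1, 0)) fun s => toLex (0, W.value s)
  coord :=
    { toFun γ o := o.elim (-(ofLex γ).1) (W.coord (ofLex γ).2)
      map_zero' := by ext (_ | s) <;> simp
      map_add' γ δ := by ext (_ | s) <;> simp [add_comm] }
  map_const ha := (laurentValue_C _ _).trans (by rw [W.map_const ha]; rfl)
  map_var
    | none => (laurentValue_single _ _ one_ne_zero).trans (by rw [W.v.map_one]; rfl)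
    | some s => (laurentValue_C _ _).trans (by rw [W.map_var]; rfl)
  value_neg
    | none => Prod.Lex.toLex_lt_toLex.2 (.inl neg_one_lt_zero)
    | some s => Prod.Lex.toLex_lt_toLex.2 (.inr ⟨rfl, W.value_neg s⟩)
  coord_value
    | none => by ext (_ | s) <;> simp
    | some s => by ext (_ | s') <;> simp [W.coord_value, Pi.single_apply]

theorem map_monomial (W : IndependentValuation c t) {a : F₀} (ha : a ≠ 0) (n : σ →₀ ℕ) :
    W.v (c a * ∏ s ∈ n.support, t s ^ n s) = (Finsupp.linearCombination ℕ W.value n : W.Γ) := by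
  simp only [W.v.map_mul, W.map_const ha, addValuation_prod, W.v.map_pow, W.map_var, zero_add,
    Finsupp.linearCombination_apply, Finsupp.sum, WithTop.coe_sum, WithTop.coe_nsmul]

theorem linearIndependent_value (W : IndependentValuation c t) : LinearIndependent ℕ W.value := by
  have coord_linearCombination (n : σ →₀ ℕ) (s : σ) :
      W.coord (Finsupp.linearCombination ℕ W.value n) s = n s := by
    simp +contextual [Finsupp.linearCombination_apply, Finsupp.sum, W.coord_value, Pi.single_apply]
  intro n n' h
  ext s
  rw [← Nat.cast_inj (R := ℤ), ← coord_linearCombination, h, coord_linearCombination]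

theorem eval₂Hom_injective (W : IndependentValuation c t) :
    Function.Injective (MvPolynomial.eval₂Hom c t) := by
  rw [injective_iff_map_eq_zero]
  intro f hf
  by_contra hf0
  obtain ⟨n, hn, hmin⟩ := f.support.exists_min_image
    (Finsupp.linearCombination ℕ W.value)
    (MvPolynomial.support_nonempty.2 hf0)
  have value {n : σ →₀ ℕ} (hn : n ∈ f.support) :
      W.v (c (f.coeff n) * ∏ s ∈ n.support, t s ^ n s) = Finsupp.linearCombination ℕ W.value n :=
    W.map_monomial (MvPolynomial.mem_support_iff.1 hn) n
  rw [MvPolynomial.coe_eval₂Hom, MvPolynomial.eval₂_eq, ← Finset.add_sum_erase _ _ hn] at hf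
  have rest_lt : (Finsupp.linearCombination ℕ W.value n : WithTop W.Γ) <
      W.v (∑ k ∈ f.support.erase n, c (f.coeff k) * ∏ s ∈ k.support, t s ^ k s) := by
    refine W.v.map_lt_sum WithTop.coe_ne_top fun k hk => ?_
    obtain ⟨hkn, hk⟩ := Finset.mem_erase.1 hk
    rw [value hk]
    exact WithTop.coe_lt_coe.2 ((hmin k hk).lt_of_ne (W.linearIndependent_value.ne hkn.symm))
  rw [← value hn, ← W.v.map_neg, neg_eq_of_add_eq_zero_right hf] at rest_lt
  exact lt_irrefl _ rest_lt

/-- The extension to the iterated Laurent series field, whose variables are added to those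
of `W`. -/
def iterLaurent : ∀ (m : ℕ) {F₀ : Type*} {K : Type u} {σ : Type} [Field F₀] [Field K]
    [DecidableEq σ] {c : F₀ →+* K} {t : σ → K}, IndependentValuation c t →
    IndependentValuation ((IterLaurent.const m K).comp c) (Sum.elim (IterLaurent.const m K ∘ t)
      (Sum.elim (IterLaurent.alpha m K) (IterLaurent.beta m K)))
  | 0, _, _, σ, _, _, _, _, _, W =>
    W.comap (RingHom.id _) (Equiv.sumEmpty σ (Fin 0 ⊕ Fin 0)).injective (fun _ => rfl) (by
      rintro (s | s)
      exacts [rfl, isEmptyElim s])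
  | m + 1, _, _, σ, _, _, _, _, _, W =>
    let j : σ ⊕ (Fin (m + 1) ⊕ Fin (m + 1)) → Option (Option σ) ⊕ (Fin m ⊕ Fin m) :=
      Sum.elim (fun s => .inl (some (some s)))
        (Sum.elim (Fin.cons (.inl (some none)) fun i => .inr (.inl i))
          (Fin.cons (.inl none) fun i => .inr (.inr i)))
    have hj : j.Injective := by
      rintro (s | i | i) (s' | i' | i') <;> try cases i using Fin.cases
      all_goals first | cases i' using Fin.cases | skip
      all_goals simp [j]
    (iterLaurent m W.laurent.laurent).comap (RingHom.id _) hj (fun _ => rfl) (by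
      rintro (s | i | i)
      · rfl
      all_goals cases i using Fin.cases <;> rfl)

/-- The valuation of the iterated Laurent series field. -/
def ofIterLaurent (m : ℕ) (F₀ : Type u) [Field F₀] :
    IndependentValuation (IterLaurent.const m F₀)
      (Sum.elim (IterLaurent.alpha m F₀) (IterLaurent.beta m F₀)) :=
  (iterLaurent m (ofTrivial F₀)).comap (RingHom.id _) Sum.inr_injective (fun _ => rfl) fun _ => rfl

/-- The restriction to the rational function field of the valuation of iterated Laurent series. -/
def ofRatField (m : ℕ) (F₀ : Type u) [Field F₀] :
    IndependentValuation (algebraMap F₀ (RatField m F₀))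
      (Sum.elim (RatField.alpha m F₀) (RatField.beta m F₀)) :=
  (ofIterLaurent m F₀).comap (IsFractionRing.lift (ofIterLaurent m F₀).eval₂Hom_injective)
    Function.injective_id
    (fun a => by
      rw [IsScalarTower.algebraMap_apply F₀ (MvPolynomial (Fin m ⊕ Fin m) F₀) (RatField m F₀),
        IsFractionRing.lift_algebraMap, MvPolynomial.algebraMap_eq, MvPolynomial.coe_eval₂Hom,
        MvPolynomial.eval₂_C])
    (by
      rintro (i | i) <;> simp [RatField.alpha, RatField.beta])

end IndependentValuation

namespace IndependentValuation

section Classes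

variable {ι F₀ F : Type*} [DecidableEq ι] [Field F₀] [Field F] {c : F₀ →+* F} {α β : ι → F}
  (W : IndependentValuation c (Sum.elim α β)) (p : ℕ)

/-- The valuation `p • v`, which makes room in the value group for `p`-th roots of the `α i` and
`β i`. -/
def scaled : AddValuation F (WithTop W.Γ) :=
  W.v.map (nsmulAddMonoidHom p).withTopMap rfl fun _ _ h =>
    WithTop.monotone_map_iff.2 (fun _ _ h => nsmul_le_nsmul_right h p) h

/-- The class of a value in the group `ι → ZMod p × ZMod p`, which kills the values of `scaled`. -/
def classHom : W.Γ →+ (ι → ZMod p × ZMod p) where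
  toFun γ i := (W.coord γ (.inl i), W.coord γ (.inr i))
  map_zero' := by ext <;> simp
  map_add' γ δ := by ext <;> simp

theorem scaled_apply (a : F) : W.scaled p a = (W.v a).map (p • ·) :=
  rfl

theorem scaled_const {a : F₀} (ha : a ≠ 0) : W.scaled p (c a) = 0 := by
  rw [scaled_apply, W.map_const ha, ← WithTop.coe_zero, WithTop.map_coe, smul_zero]

theorem scaled_var (s : ι ⊕ ι) : W.scaled p (Sum.elim α β s) = (p • W.value s : W.Γ) := by
  rw [scaled_apply, W.map_var, WithTop.map_coe]

theorem scaled_natCast {k : ℕ} (hk : (k : F) ≠ 0) : W.scaled p k = 0 := by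
  rw [← map_natCast c] at hk ⊢
  exact W.scaled_const p (ne_zero_of_map hk)

theorem var_ne_zero (W : IndependentValuation c (Sum.elim α β)) (s : ι ⊕ ι) :
    Sum.elim α β s ≠ 0 :=
  W.v.ne_top_iff.1 (W.map_var s ▸ WithTop.coe_ne_top)

theorem classHom_of_scaled_eq {a : F} {γ : W.Γ} (h : W.scaled p a = γ) : W.classHom p γ = 0 := by
  obtain ⟨δ, -, rfl⟩ := WithTop.map_eq_some_iff.1 h
  ext <;> simp [classHom]

theorem classHom_value_inl (i : ι) : W.classHom p (W.value (.inl i)) = Pi.single i (1, 0) := by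
  ext j <;> obtain rfl | hij := eq_or_ne j i <;> simp [classHom, W.coord_value, *]

theorem classHom_value_inr (i : ι) : W.classHom p (W.value (.inr i)) = Pi.single i (0, 1) := by
  ext j <;> obtain rfl | hij := eq_or_ne j i <;> simp [classHom, W.coord_value, *]

end Classes

section RankBound

open scoped LinearAlgebra.Projectivization

variable {ι : Type} {F₀ : Type*} {F : Type u} [DecidableEq ι] [Field F₀] [Field F] {c : F₀ →+* F}
  {α β : ι → F} (W : IndependentValuation c (Sum.elim α β)) {p : ℕ} {Q : ι → Type u}
  [∀ i, Ring (Q i)] [∀ i, Algebra F (Q i)] {ρ ε : F₀} {x y : ∀ i, Q i}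
  {B : ∀ i, Basis (ZMod p × ZMod p) F (Q i)}

theorem isValuedSymbol (hρ : ρ ≠ 0) {i : ι}
    (hxy : IsSymbolPair p (c ρ) (c ε) (α i) (β i) (x i) (y i))
    (hB : ∀ g, B i g = symbolMonomial (x i) (y i) g) :
    IsValuedSymbol (W.scaled p) (c ρ) (c ε) (α i) (β i) (x i) (y i) (B i) (W.value (.inl i))
      (W.value (.inr i)) :=
  { hxy with
    basis_eq := hB
    value_left := W.scaled_var p (.inl i)
    value_right := W.scaled_var p (.inr i)
    left_neg := W.value_neg _
    root_nonneg := (W.scaled_const p hρ).ge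
    shift_nonneg := by
      obtain rfl | hε := eq_or_ne ε 0
      · simp
      · exact (W.scaled_const p hε).ge }

theorem rank_le_of_reducedTrace_pow_eq_zero (W : IndependentValuation c (Sum.elim α β))
    [Fintype ι] [Fact p.Prime] (hp : ((p - 1).factorial : F) ≠ 0) (hρ : ρ ≠ 0)
    (hxy : ∀ i, IsSymbolPair p (c ρ) (c ε) (α i) (β i) (x i) (y i))
    (hB : ∀ i g, B i g = symbolMonomial (x i) (y i) g)
    {φ : ∀ i, Q i →ₐ[F] Matrix (ZMod p) (ZMod p) (AlgebraicClosure F)} {g₀ : ZMod p × ZMod p}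
    {τ : F} (hφ : ∀ i, IsSplitting (B i) (φ i) g₀ τ) (hτ : τ ≠ 0) (hg₀ : g₀ = 0 ∨ ρ = 1)
    {V : Submodule F (⨂[F] i, Q i)} (hV : ∀ a ∈ V, reducedTrace F (a ^ (p - 1)) = 0) :
    Module.rank F V ≤ (((p ^ (2 * Fintype.card ι) - 1) / (p - 1) : ℕ) : Cardinal) := by
  have one_lt : 1 < p := (Fact.out : p.Prime).one_lt
  have valued (i : ι) := W.isValuedSymbol hρ (hxy i) (hB i)
  have armature (i : ι) := (valued i).isArmature one_lt
    (π := (Pi.evalAddMonoidHom _ i).comp (W.classHom p))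
    (fun h => congrFun (W.classHom_of_scaled_eq p h) i)
    (by simp [classHom_value_inl]) (by simp [classHom_value_inr])
  have tensor_armature := IsArmature.piTensorProduct armature fun i j g hj => by
    simp [monomialValue, classHom_value_inl, classHom_value_inr, hj]
  have card_lines : Nat.card (ℙ (ZMod p) (ι → ZMod p × ZMod p)) =
      (p ^ (2 * Fintype.card ι) - 1) / (p - 1) := by
    simp [Projectivization.card'', Nat.card_eq_fintype_card, pow_mul, pow_two]
  rw [← card_lines]
  refine tensor_armature.rank_le_card_projectivization (g₀ := fun _ => g₀) hp
    (fun k => W.scaled_natCast p) ?_ fun a ha => ?_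
  · refine hg₀.imp (fun h => funext fun _ => h) ?_
    rintro rfl
    rw [map_one] at valued
    exact IsArmature.leadingCommute_basis_piTensorProduct armature
      (fun i => (valued i).leadingCommute_basis one_lt (armature i)) tensor_armature
  · have trace_eq := hV a ha
    rw [(IsSplitting.piTensorProduct hφ).reducedTrace_eq] at trace_eq
    exact (mul_eq_zero.1 trace_eq).resolve_left (Finset.prod_ne_zero_iff.2 fun _ _ => hτ)

end RankBound

end IndependentValuation

theorem factorial_cast_ne_zero {K : Type*} [Field K] {n : ℕ}
    (h : ringChar K = 0 ∨ n < ringChar K) : (n.factorial : K) ≠ 0 := by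
  rw [Ne, ringChar.spec]
  obtain h | h := h
  · simpa [h] using n.factorial_ne_zero
  · obtain hprime | hzero := CharP.char_is_prime_or_zero K (ringChar K)
    · rwa [hprime.dvd_factorial, not_le]
    · simp [hzero] at h

theorem symbolTensor_rank_le {p : ℕ} [Fact p.Prime] {m : ℕ} {F₀ : Type*} {F : Type u} [Field F₀]
    [Field F] {c : F₀ →+* F} {α β : Fin m → F} (W : IndependentValuation c (Sum.elim α β))
    (hp : ((p - 1).factorial : F) ≠ 0) {ρ : F₀} (hρ : IsPrimitiveRoot ρ p)
    {V : Submodule F (SymbolTensor p m (c ρ) α β)}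
    (hV : ∀ a ∈ V, reducedTrace F (a ^ (p - 1)) = 0) :
    Module.rank F V ≤ (((p ^ (2 * m) - 1) / (p - 1) : ℕ) : Cardinal) := by
  have prime : p.Prime := Fact.out
  have hρF : IsPrimitiveRoot (c ρ) p := hρ.map_of_injective c.injective
  choose x y hxy using fun i => SymbolAlgebra.exists_isSymbolAlgebra p (c ρ) (α i) (β i)
  choose B φ hB hφ using fun i => (hxy i).exists_isSplitting_of_isPrimitiveRoot
    (K := AlgebraicClosure F) prime.one_lt hρF (W.var_ne_zero (.inl i))
    (W.var_ne_zero (.inr i))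
  simpa using W.rank_le_of_reducedTrace_pow_eq_zero hp (hρ.ne_zero prime.ne_zero) (ε := 0)
    (fun i => by simpa using (hxy i).toIsSymbolPair) hB hφ hρF.neZero'.ne (.inl rfl) hV

theorem charPSymbolTensor_rank_le {p : ℕ} [Fact p.Prime] {m : ℕ} {F₀ : Type*} {F : Type u}
    [Field F₀] [Field F] [CharP F p] {c : F₀ →+* F} {α β : Fin m → F}
    (W : IndependentValuation c (Sum.elim α β)) {V : Submodule F (CharPSymbolTensor p m α β)}
    (hV : ∀ a ∈ V, reducedTrace F (a ^ (p - 1)) = 0) :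
    Module.rank F V ≤ (((p ^ (2 * m) - 1) / (p - 1) : ℕ) : Cardinal) := by
  have factorial : ((p - 1).factorial : F) ≠ 0 := by
    refine factorial_cast_ne_zero (.inr ?_)
    rw [ringChar.eq F p]
    exact Nat.sub_one_lt (NeZero.ne p)
  choose x y hxy using fun i => CharPSymbolAlgebra.exists_isSymbolAlgebra p (α i) (β i)
  choose B φ hB hφ using fun i => (hxy i).exists_isSplitting_of_charP
    (K := AlgebraicClosure F) (W.var_ne_zero (.inr i))
  simpa using W.rank_le_of_reducedTrace_pow_eq_zero factorial (ρ := 1) (ε := 1) one_ne_zero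
    (fun i => by simpa using (hxy i).toIsSymbolPair) hB hφ (neg_ne_zero.2 one_ne_zero) (.inr rfl) hV

theorem mainTheorem1_general {p : ℕ} (hp : p.Prime) {m : ℕ} {F₀ : Type*} {F : Type u} [Field F₀]
    [Field F] (hchar : ringChar F₀ = 0 ∨ p ≤ ringChar F₀) {c : F₀ →+* F} {α β : Fin m → F}
    (W : IndependentValuation c (Sum.elim α β)) :
    (∀ ρ : F₀, IsPrimitiveRoot ρ p →
      ∀ V : Submodule F (SymbolTensor p m (c ρ) α β),
        (∀ v ∈ V, reducedTrace F (v ^ (p - 1)) = 0) →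
          Module.rank F V ≤ (((p ^ (2 * m) - 1) / (p - 1) : ℕ) : Cardinal)) ∧
    (ringChar F₀ = p →
      ∀ V : Submodule F (CharPSymbolTensor p m α β),
        (∀ v ∈ V, reducedTrace F (v ^ (p - 1)) = 0) →
          Module.rank F V ≤ (((p ^ (2 * m) - 1) / (p - 1) : ℕ) : Cardinal)) := by
  have : Fact p.Prime := ⟨hp⟩
  refine ⟨fun ρ hρ V hV => ?_, fun heq V hV => ?_⟩
  · refine symbolTensor_rank_le W ?_ hρ hV
    rw [← map_natCast c, map_ne_zero]
    exact factorial_cast_ne_zero (hchar.imp_right (Nat.sub_one_lt_of_lt hp.pos).trans_le)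
  · have : CharP F₀ p := ringChar.of_eq heq
    have : CharP F p := charP_of_injective_ringHom c.injective p
    exact charPSymbolTensor_rank_le W hV

end

theorem mainTheorem1 (p : ℕ) (hp : p.Prime) (m : ℕ) (F₀ : Type u) [Field F₀]
    (hchar : ringChar F₀ = 0 ∨ p ≤ ringChar F₀) :
    (ringChar F₀ ≠ p → ∀ ρ : F₀, IsPrimitiveRoot ρ p →
      (∀ V : Submodule (RatField m F₀)
          (SymbolTensor p m (algebraMap F₀ (RatField m F₀) ρ)
            (RatField.alpha m F₀) (RatField.beta m F₀)),
        (∀ v ∈ V, reducedTrace (RatField m F₀) (v ^ (p - 1)) = 0) →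
          Module.rank (RatField m F₀) V ≤ (((p ^ (2 * m) - 1) / (p - 1) : ℕ) : Cardinal)) ∧
      (∀ V : Submodule (IterLaurent m F₀)
          (SymbolTensor p m (IterLaurent.const m F₀ ρ)
            (IterLaurent.alpha m F₀) (IterLaurent.beta m F₀)),
        (∀ v ∈ V, reducedTrace (IterLaurent m F₀) (v ^ (p - 1)) = 0) →
          Module.rank (IterLaurent m F₀) V ≤ (((p ^ (2 * m) - 1) / (p - 1) : ℕ) : Cardinal))) ∧
    (ringChar F₀ = p →
      (∀ V : Submodule (RatField m F₀)
          (CharPSymbolTensor p m (RatField.alpha m F₀) (RatField.beta m F₀)),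
        (∀ v ∈ V, reducedTrace (RatField m F₀) (v ^ (p - 1)) = 0) →
          Module.rank (RatField m F₀) V ≤ (((p ^ (2 * m) - 1) / (p - 1) : ℕ) : Cardinal)) ∧
      (∀ V : Submodule (IterLaurent m F₀)
          (CharPSymbolTensor p m (IterLaurent.alpha m F₀) (IterLaurent.beta m F₀)),
        (∀ v ∈ V, reducedTrace (IterLaurent m F₀) (v ^ (p - 1)) = 0) →
          Module.rank (IterLaurent m F₀) V ≤ (((p ^ (2 * m) - 1) / (p - 1) : ℕ) : Cardinal))) := by
  let W₁ := IndependentValuation.ofRatField m F₀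
  let W₂ := IndependentValuation.ofIterLaurent m F₀
  exact ⟨fun _ ρ hρ =>
      ⟨(mainTheorem1_general hp hchar W₁).1 ρ hρ, (mainTheorem1_general hp hchar W₂).1 ρ hρ⟩,
    fun heq => ⟨(mainTheorem1_general hp hchar W₁).2 heq, (mainTheorem1_general hp hchar W₂).2 heq⟩⟩
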